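/- For $n\in\{2,3\}$, consider $C^\infty$ curves $\gamma:[0,1]\to\mathbb S^n\subset\mathbb R^{n+1}$ (derivatives at the end points are one-sided) that are generic, i.e. $\gamma(t),\gamma'(t),\dots,\gamma^{(n-1)}(t)$ are linearly independent for all $t\in[0,1]$. The Frenet frame $\mathcal F_\gamma(t)\in\mathrm{SO}_{n+1}$ has as its first $n$ columns the Gram–Schmidt orthonormalization of $\gamma(t),\gamma'(t),\dots,\gamma^{(n-1)}(t)$ and as its last column the vector that completes them to a positive orthonormal basis. Let $\mathbb S^3$ also denote the group of unit quaternions. Put $\mathrm{Spin}_3=\mathbb S^3$ with the covering $\Pi_3:\mathrm{Spin}_3\to\mathrm{SO}_3$, $\Pi_3(z)h=zh\bar z$ on the imaginary quaternions with basis $\mathbf i,\mathbf j,\mathbf k$, and $\mathrm{Spin}_4=\mathbb S^3\times\mathbb S^3$ with the covering $\Pi_4:\mathrm{Spin}_4\to\mathrm{SO}_4$, $\Pi_4(z_l,z_r)q=z_lq\bar z_r$ on the quaternions with basis $\mathbf 1,\mathbf i,\mathbf j,\mathbf k$. If $\mathcal F_\gamma(0)=I$, let $\tilde{\mathcal F}_\gamma:[0,1]\to\mathrm{Spin}_{n+1}$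 be the continuous lift of $\mathcal F_\gamma$ with $\tilde{\mathcal F}_\gamma(0)=\mathbf 1$. For $z\in\mathrm{Spin}_{n+1}$ let $\mathcal G\mathbb S^n(z)$ be the space of all generic curves $\gamma$ in $\mathbb S^n$ with $\mathcal F_\gamma(0)=I$, $\mathcal F_\gamma(1)=\Pi_{n+1}(z)$ and $\tilde{\mathcal F}_\gamma(1)=z$, with the $C^\infty$ topology (uniform convergence of all derivatives on $[0,1]$). Let $\mathbf t_\gamma=\gamma'/\|\gamma'\|$, let $\mathbf n_\gamma$ be the third column of $\mathcal F_\gamma$, and, if $n=3$, let $\mathbf b_\gamma$ be its fourth column. The geodesic curvature is $\kappa_\gamma=\mathbf t_\gamma'\cdot\mathbf n_\gamma/\|\gamma'\|$ and, if $n=3$, the geodesic torsion is $\tau_\gamma=-\mathbf b_\gamma'\cdot\mathbf n_\gamma/\|\gamma'\|$. **Theorem 3.** Let $z_l,z_r\in\mathbb S^3$. There is a homeomorphism $\gamma\mapsto(\gamma_l,\gamma_r)$ from $\mathcal G\mathbb S^3(z_l,z_r)$ onto the space of pairs $(\gamma_l,\gamma_r)\in\mathcal G\mathbb S^2(z_l)\times\mathcal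 G\mathbb S^2(z_r)$ with $$\|\gamma_l'(t)\|=\|\gamma_r'(t)\|,\qquad \kappa_{\gamma_l}(t)>\kappa_{\gamma_r}(t),\qquad t\in[0,1],$$ such that $\tilde{\mathcal F}_\gamma=(\tilde{\mathcal F}_{\gamma_l},\tilde{\mathcal F}_{\gamma_r})$ for every $\gamma\in\mathcal G\mathbb S^3(z_l,z_r)$ and such that, for all $t\in[0,1]$, $\|\gamma'(t)\|>0$, $\kappa_\gamma(t)>0$ and $$\|\gamma_l'\|=\|\gamma_r'\|=\|\gamma'\|\,\kappa_\gamma,\qquad \kappa_{\gamma_l}=\frac{\tau_\gamma+1}{\kappa_\gamma},\qquad \kappa_{\gamma_r}=\frac{\tau_\gamma-1}{\kappa_\gamma},$$ $$\kappa_\gamma=\frac{2}{\kappa_{\gamma_l}-\kappa_{\gamma_r}},\qquad \tau_\gamma=\frac{\kappa_{\gamma_l}+\kappa_{\gamma_r}}{\kappa_{\gamma_l}-\kappa_{\gamma_r}},\qquad \|\gamma'\|=\frac{\|\gamma_l'\|\,(\kappa_{\gamma_l}-\kappa_{\gamma_r})}{2}.$$ -/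

import Mathlib

open scoped ContDiff unitInterval

namespace SphereCurves

/-! ## Smooth curves on the closed interval and their topology -/

/-- The Euclidean space `ℝᵐ`. -/
abbrev Euc (m : ℕ) : Type := EuclideanSpace ℝ (Fin m)

section Curves

variable {E : Type*} [NormedAddCommGroup E] [NormedSpace ℝ E]

/-- The `k`-th derivative of a curve `f : [0,1] → E`, one-sided at the end points. It is computed
within `[0,1]` and only depends on the values of `f` on `[0,1]`. -/
noncomputable def derivN (k : ℕ) (f : I → E) (t : I) : E :=
  iteratedDerivWithin k (Set.IccExtend zero_le_one f) (Set.Icc (0 : ℝ) 1) (t : ℝ)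

/-- The velocity `f'(t)` of a curve `f : [0,1] → E`, one-sided at the end points. -/
noncomputable def vel (f : I → E) (t : I) : E :=
  derivWithin (Set.IccExtend zero_le_one f) (Set.Icc (0 : ℝ) 1) (t : ℝ)

variable (E) in
/-- Curves `[0,1] → E` of class `C^∞` (up to the end points). -/
structure SmoothCurve where
  /-- the underlying map -/
  toFun : I → E
  smooth : ContDiffOn ℝ ∞ (Set.IccExtend zero_le_one toFun) (Set.Icc (0 : ℝ) 1)

instance : CoeFun (SmoothCurve E) (fun _ => I → E) := ⟨SmoothCurve.toFun⟩

/-- The `C^∞` topology: uniform convergence on `[0,1]` of the curves and of each of their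
derivatives. -/
noncomputable instance : TopologicalSpace (SmoothCurve E) :=
  TopologicalSpace.induced
    (fun (γ : SmoothCurve E) (k : ℕ) => UniformFun.ofFun (derivN k γ)) inferInstance

end Curves

/-! ## Generic curves on spheres and the Frenet frame -/

section Frenet

variable {n : ℕ}

/-- `γ` is a generic curve on the unit sphere `𝕊ⁿ ⊆ ℝⁿ⁺¹`: the vectors
`γ(t), γ'(t), …, γ⁽ⁿ⁻¹⁾(t)` are linearly independent for all `t`. -/
def IsGeneric (γ : SmoothCurve (Euc (n + 1))) : Prop :=
  (∀ t, ‖γ t‖ = 1) ∧ ∀ t, LinearIndependent ℝ (fun j : Fin n => derivN j γ t)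

/-- The generalized cross product of `n` vectors of `ℝⁿ⁺¹`: the vector `c` with
`⟪c, x⟫ = det (u₀, …, uₙ₋₁, x)` for all `x`. -/
noncomputable def cross (u : Fin n → Euc (n + 1)) : Euc (n + 1) :=
  WithLp.toLp 2 fun i =>
    (Matrix.of fun a b =>
      (Fin.snoc (α := fun _ => Euc (n + 1)) u (EuclideanSpace.single i (1 : ℝ)) b) a).det

/-- The Frenet vectors `u₀(t), …, uₙ(t)` of a curve on `𝕊ⁿ`: the first `n` of them come from
`γ(t), γ'(t), …, γ⁽ⁿ⁻¹⁾(t)` by Gram-Schmidt orthonormalization, the last one completes them to a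
positive orthonormal basis. -/
noncomputable def frenetVec (γ : SmoothCurve (Euc (n + 1))) (t : I) : Fin (n + 1) → Euc (n + 1) :=
  Fin.snoc (α := fun _ => Euc (n + 1))
    (InnerProductSpace.gramSchmidtNormed ℝ (fun j : Fin n => derivN j γ t))
    (cross (InnerProductSpace.gramSchmidtNormed ℝ (fun j : Fin n => derivN j γ t)))

/-- The Frenet frame `𝓕_γ(t)`: the matrix with columns `u₀(t), …, uₙ(t)`. -/
noncomputable def frenetFrame (γ : SmoothCurve (Euc (n + 1))) (t : I) :
    Matrix (Fin (n + 1)) (Fin (n + 1)) ℝ :=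
  Matrix.of fun i j => frenetVec γ t j i

/-- The unit tangent vector `γ'(t) / ‖γ'(t)‖`. -/
noncomputable def unitTangent (γ : SmoothCurve (Euc (n + 1))) (t : I) : Euc (n + 1) :=
  ‖vel γ t‖⁻¹ • vel γ t

/-- The geodesic curvature `κ_γ = ⟪𝐭', 𝐧⟫ / ‖γ'‖` of a generic curve on `𝕊ⁿ`, `n ≥ 2`, where the
unit normal `𝐧` is the third Frenet vector (`𝐧 = γ × 𝐭` if `n = 2`). -/
noncomputable def geodCurv (γ : SmoothCurve (Euc (n + 1))) (t : I) : ℝ :=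
  inner ℝ (vel (unitTangent γ) t) (frenetVec γ t 2) / ‖vel γ t‖

/-- The geodesic torsion `τ_γ = -⟪𝐛', 𝐧⟫ / ‖γ'‖` of a generic curve on `𝕊³`, where the unit
normal `𝐧` and the binormal `𝐛` are the third and the fourth Frenet vector. -/
noncomputable def geodTors (γ : SmoothCurve (Euc (3 + 1))) (t : I) : ℝ :=
  -inner ℝ (vel (fun s => frenetVec γ s 3) t) (frenetVec γ t 2) / ‖vel γ t‖

/-- `w` is the lifted Frenet frame of `γ` with respect to the covering `cov : S → SOₙ₊₁`: the
continuous lift of `𝓕_γ` that starts at the identity. -/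
def IsLiftedFrame {S : Type*} [TopologicalSpace S] [One S]
    (cov : S → Matrix (Fin (n + 1)) (Fin (n + 1)) ℝ)
    (γ : SmoothCurve (Euc (n + 1))) (w : C(I, S)) : Prop :=
  w 0 = 1 ∧ ∀ t, cov (w t) = frenetFrame γ t

/-- The space `𝓖𝕊ⁿ(Q)`, as a predicate on smooth curves. -/
def InGQ (Q : Matrix (Fin (n + 1)) (Fin (n + 1)) ℝ) (γ : SmoothCurve (Euc (n + 1))) : Prop :=
  IsGeneric γ ∧ frenetFrame γ 0 = 1 ∧ frenetFrame γ 1 = Q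

/-- The space `𝓖𝕊ⁿ(z)` for `z` in a group `S` covering `SOₙ₊₁`, with the `C^∞` topology: the
curves in `𝓖𝕊ⁿ(cov z)` whose lifted Frenet frame ends at `z`. -/
abbrev G {S : Type*} [TopologicalSpace S] [One S]
    (cov : S → Matrix (Fin (n + 1)) (Fin (n + 1)) ℝ) (z : S) : Type :=
  {γ : SmoothCurve (Euc (n + 1)) // InGQ (cov z) γ ∧ ∃ w : C(I, S), IsLiftedFrame cov γ w ∧ w 1 = z}

end Frenet

/-! ## The spin groups `Spin₃ = 𝕊³` and `Spin₄ = 𝕊³ × 𝕊³` -/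

/-- `Spin₃`, the group of unit quaternions. -/
abbrev Spin3 : Type := Metric.sphere (0 : Quaternion ℝ) 1

/-- `Spin₄`, the group of pairs of unit quaternions. -/
abbrev Spin4 : Type := Spin3 × Spin3

/-- The coordinates of a quaternion in the basis `1, 𝐢, 𝐣, 𝐤`. -/
def coords (q : Quaternion ℝ) : Fin 4 → ℝ := ![q.re, q.imI, q.imJ, q.imK]

/-- The basis `1, 𝐢, 𝐣, 𝐤` of the quaternions. -/
def unitQ : Fin 4 → Quaternion ℝ := ![⟨1, 0, 0, 0⟩, ⟨0, 1, 0, 0⟩, ⟨0, 0, 1, 0⟩, ⟨0, 0, 0, 1⟩]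

/-- `Π₃ : Spin₃ → SO₃`, the matrix of `h ↦ z h z̄` on the imaginary quaternions, in the basis
`𝐢, 𝐣, 𝐤`. -/
noncomputable def Pi3 (z : Spin3) : Matrix (Fin 3) (Fin 3) ℝ :=
  Matrix.of fun i j => coords ((z : Quaternion ℝ) * unitQ j.succ * star (z : Quaternion ℝ)) i.succ

/-- `Π₄ : Spin₄ → SO₄`, the matrix of `q ↦ z_l q z̄_r` on the quaternions, in the basis
`1, 𝐢, 𝐣, 𝐤`. -/
noncomputable def Pi4 (z : Spin4) : Matrix (Fin 4) (Fin 4) ℝ :=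
  Matrix.of fun i j => coords ((z.1 : Quaternion ℝ) * unitQ j * star (z.2 : Quaternion ℝ)) i

/-- The space `𝓖𝕊²(z)`. -/
abbrev GS2 (z : Spin3) : Type := G (n := 2) Pi3 z

/-- The space `𝓖𝕊³(z_l, z_r)`. -/
abbrev GS3 (zl zr : Spin3) : Type := G (n := 3) Pi4 ((zl, zr) : Spin4)

/-- The space of pairs `(γ_l, γ_r) ∈ 𝓖𝕊²(z_l) × 𝓖𝕊²(z_r)` with equal speeds and
`κ_{γ_l} > κ_{γ_r}`. -/
abbrev PairSpace (zl zr : Spin3) : Type :=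
  {p : GS2 zl × GS2 zr //
    ∀ t, ‖vel p.1.1 t‖ = ‖vel p.2.1 t‖ ∧ geodCurv p.1.1 t > geodCurv p.2.1 t}

end SphereCurves

open SphereCurves

/-!
A unit quaternion `z` is a frame of `ℝ³`: the rotated basis `z 𝐢 z̄, z 𝐣 z̄, z 𝐤 z̄`. A pair
`(a, b)` of unit quaternions is the frame `a b̄, a 𝐢 b̄, a 𝐣 b̄, a 𝐤 b̄` of `ℝ⁴`. If the latter is the Frenet
frame `(γ, 𝐭, 𝐧, 𝐛)` of a curve `γ` on `𝕊³`, then `𝐭 γ̄ = a 𝐢 ā` and `γ̄ 𝐭 = b 𝐢 b̄`, and the curves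
`γₗ = 𝐭 γ̄`, `γᵣ = γ̄ 𝐭` on `𝕊²` move along `a 𝐣 ā` and `b 𝐣 b̄` with the speed `‖γ'‖ κ > 0`; so `a` and
`b` are their lifted Frenet frames, and differentiating once more gives the geodesic curvatures
`(τ ± 1) / κ` (`leftCurve_frenet`, `rightCurve_frenet`). The remaining formulas are algebra.

Conversely, given a pair `(γₗ, γᵣ)` with lifted frames `wₗ`, `wᵣ`, the inverse map is `γ = wₗ w̄ᵣ`.
A lift is differentiable because it is, locally, the normalization of an affine function of the
rotation it covers, and it solves `w' = w (‖γₗ'‖ / 2) (κ 𝐢 + 𝐤)` (`hasVel_lift`). Hence the frame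
given by `(wₗ, wᵣ)` satisfies the Frenet equations on `𝕊³` with the speed
`v = ‖γₗ'‖ (κₗ - κᵣ) / 2 > 0`, and is the Frenet frame of `γ` (`pairCurve_frenet`). The two maps are
inverse to each other since lifts are unique (`IsLiftedFrame.unique`).

For the `C^∞` topology, continuity of a map `x ↦ f x` into the space of smooth curves is, by
compactness of `[0,1]`, joint continuity in `(x, t)` of all time derivatives of `f x t`; families
with this property (`SmoothFamily`) are closed under derivatives, products, inverses and norms.
The map `γ ↦ (𝐭 γ̄, γ̄ 𝐭)` is built from such operations. For the inverse map, `γ = wₗ w̄ᵣ` solves the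
linear equation `γ' = (v γₗ) γ` with an imaginary coefficient that depends smoothly on the pair; two
unit solutions are as close as their coefficients, and the equation then gives the continuity of
the higher derivatives (`smoothFamily_of_skew_ode`).
-/

namespace SphereCurves

open Set
open scoped Topology

/-! ### Derivatives of curves on the closed interval -/

section Calculus

variable {E F H : Type*} [NormedAddCommGroup E] [NormedSpace ℝ E] [NormedAddCommGroup F]
  [NormedSpace ℝ F] [NormedAddCommGroup H] [NormedSpace ℝ H]

/-- The curve `f : [0,1] → E` has the (at the end points one-sided) derivative `f'` at `t`. -/
def HasVel (f : I → E) (f' : E) (t : I) : Prop :=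
  HasDerivWithinAt (Set.IccExtend zero_le_one f) f' (Set.Icc (0 : ℝ) 1) (t : ℝ)

/-- Quaternion conjugation as a continuous linear map. -/
noncomputable def quatConj : Quaternion ℝ →L[ℝ] Quaternion ℝ :=
  LinearMap.mkContinuous
    { toFun := star
      map_add' := star_add
      map_smul' := fun r q => by simp }
    1 fun q => by simp

theorem uniqueDiff (t : I) : UniqueDiffWithinAt ℝ (Icc (0 : ℝ) 1) t :=
  uniqueDiffOn_Icc_zero_one _ t.2

theorem extend_coe {E : Type*} (f : I → E) (t : I) : Set.IccExtend zero_le_one f (t : ℝ) = f t := by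
  simp

namespace HasVel

variable {f : I → E} {f' : E} {g : I → F} {g' : F} {t : I}

theorem vel_eq (h : HasVel f f' t) : vel f t = f' := h.derivWithin (uniqueDiff t)

theorem unique {f'' : E} (h : HasVel f f' t) (h' : HasVel f f'' t) : f' = f'' :=
  h.vel_eq.symm.trans h'.vel_eq

theorem congr (h : HasVel f f' t) {a : E} (e : f' = a) : HasVel f a t := e ▸ h

theorem const (c : E) (t : I) : HasVel (fun _ => c) 0 t := hasDerivWithinAt_const _ _ _

theorem add {g : I → E} {g' : E} (h : HasVel f f' t) (k : HasVel g g' t) :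
    HasVel (fun s => f s + g s) (f' + g') t := HasDerivWithinAt.add h k

theorem bilin (B : E →L[ℝ] F →L[ℝ] H) (h : HasVel f f' t) (k : HasVel g g' t) :
    HasVel (fun s => B (f s) (g s)) (B f' (g t) + B (f t) g') t := by
  have := B.hasDerivWithinAt_of_bilinear (𝕜 := ℝ) h k
  simp only [extend_coe] at this
  rw [add_comm]
  exact this

theorem clm (L : E →L[ℝ] F) (h : HasVel f f' t) : HasVel (fun s => L (f s)) (L f') t :=
  L.hasFDerivAt.comp_hasDerivWithinAt _ h

theorem inner {E : Type*} [NormedAddCommGroup E] [InnerProductSpace ℝ E] {f g : I → E} {f' g' : E}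
    (h : HasVel f f' t) (k : HasVel g g' t) :
    HasVel (fun s => inner ℝ (f s) (g s)) (inner ℝ f' (g t) + inner ℝ (f t) g') t :=
  bilin (innerSL ℝ) h k

theorem smul {f : I → ℝ} {f' : ℝ} (h : HasVel f f' t) (k : HasVel g g' t) :
    HasVel (fun s => f s • g s) (f' • g t + f t • g') t :=
  bilin (ContinuousLinearMap.lsmul ℝ ℝ) h k

theorem mul {A : Type*} [NormedRing A] [NormedAlgebra ℝ A] {f g : I → A} {f' g' : A}
    (h : HasVel f f' t) (k : HasVel g g' t) :
    HasVel (fun s => f s * g s) (f' * g t + f t * g') t :=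
  bilin (ContinuousLinearMap.mul ℝ A) h k

theorem inv {f : I → ℝ} {f' : ℝ} (h : HasVel f f' t) (h0 : f t ≠ 0) :
    HasVel (fun s => (f s)⁻¹) (-(((f t)⁻¹ * (f t)⁻¹) * f')) t := by
  have := HasDerivWithinAt.inv (c := Set.IccExtend zero_le_one f) h (by simpa using h0)
  simp only [extend_coe] at this
  refine HasVel.congr (f := fun s => (f s)⁻¹) this ?_
  field_simp

theorem sqrt {f : I → ℝ} {f' : ℝ} (h : HasVel f f' t) (h0 : f t ≠ 0) :
    HasVel (fun s => √(f s)) (((2 : ℝ) * √(f t))⁻¹ * f') t := by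
  have := HasDerivWithinAt.sqrt (f := Set.IccExtend zero_le_one f) h (by simpa using h0)
  simp only [extend_coe] at this
  refine HasVel.congr (f := fun s => √(f s)) this ?_
  field_simp

theorem star {f : I → Quaternion ℝ} {f' : Quaternion ℝ} (h : HasVel f f' t) :
    HasVel (fun s => star (f s)) (star f') t :=
  h.clm quatConj

end HasVel

/-! ### Families of curves with jointly continuous jets -/

variable {X Y : Type*} [TopologicalSpace X] [TopologicalSpace Y]

/-- A family `f x : [0,1] → E` of curves, indexed by a topological space `X`, is `k` times
differentiable in the time `t`, with time derivatives up to order `k` that are jointly continuous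
in `(x, t)`. -/
def JetCont : ℕ → (X → I → E) → Prop
  | 0, f => Continuous fun p : X × I => f p.1 p.2
  | k + 1, f => (Continuous fun p : X × I => f p.1 p.2) ∧
      (∀ x t, HasVel (f x) (vel (f x) t) t) ∧ JetCont k fun x => vel (f x)

/-- All time derivatives of the family `f x : [0,1] → E` exist and are jointly continuous in the
parameter and in time. -/
def SmoothFamily (f : X → I → E) : Prop := ∀ k, JetCont k f

namespace JetCont

variable {k : ℕ} {f : X → I → E} {g : X → I → F}

theorem continuous (h : JetCont k f) : Continuous fun p : X × I => f p.1 p.2 := by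
  cases k with
  | zero => exact h
  | succ k => exact h.1

theorem pred (h : JetCont (k + 1) f) : JetCont k f := by
  induction k generalizing f with
  | zero => exact h.1
  | succ k ih => exact ⟨h.1, h.2.1, ih h.2.2⟩

theorem succ_of_hasVel {f' : X → I → E} (h : Continuous fun p : X × I => f p.1 p.2)
    (h' : ∀ x t, HasVel (f x) (f' x t) t) (hk : JetCont k f') : JetCont (k + 1) f := by
  have e : (fun x => vel (f x)) = f' := by
    ext x t
    exact (h' x t).vel_eq
  refine ⟨h, fun x t => ?_, e ▸ hk⟩
  rw [(h' x t).vel_eq]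
  exact h' x t

theorem comp (h : JetCont k f) {u : Y → X} (hu : Continuous u) : JetCont k fun y => f (u y) := by
  induction k generalizing f with
  | zero =>
    change Continuous ((fun p : X × I => f p.1 p.2) ∘ fun p : Y × I => (u p.1, p.2))
    exact Continuous.comp h (by fun_prop)
  | succ k ih =>
    refine ⟨?_, fun y t => h.2.1 (u y) t, ih h.2.2⟩
    change Continuous ((fun p : X × I => f p.1 p.2) ∘ fun p : Y × I => (u p.1, p.2))
    exact h.1.comp (by fun_prop)

theorem const (c : E) : JetCont k fun (_ : X) (_ : I) => c := by
  induction k generalizing c with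
  | zero => exact continuous_const
  | succ k ih => exact succ_of_hasVel continuous_const (fun _ t => HasVel.const c t) (ih 0)

theorem add {g : X → I → E} (h : JetCont k f) (h' : JetCont k g) :
    JetCont k fun x t => f x t + g x t := by
  induction k generalizing f g with
  | zero => exact h.continuous.add h'.continuous
  | succ k ih =>
    exact succ_of_hasVel (h.continuous.add h'.continuous)
      (fun x t => (h.2.1 x t).add (h'.2.1 x t)) (ih h.2.2 h'.2.2)

theorem bilin (B : E →L[ℝ] F →L[ℝ] H) (h : JetCont k f) (h' : JetCont k g) :
    JetCont k fun x t => B (f x t) (g x t) := by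
  induction k generalizing f g with
  | zero => exact B.continuous₂.comp (h.continuous.prodMk h'.continuous)
  | succ k ih =>
    exact succ_of_hasVel (B.continuous₂.comp (h.continuous.prodMk h'.continuous))
      (fun x t => (h.2.1 x t).bilin B (h'.2.1 x t))
      ((ih h.2.2 h'.pred).add (ih h.pred h'.2.2))

theorem clm (L : E →L[ℝ] F) (h : JetCont k f) : JetCont k fun x t => L (f x t) := by
  induction k generalizing f with
  | zero => exact L.continuous.comp h.continuous
  | succ k ih =>
    exact succ_of_hasVel (L.continuous.comp h.continuous) (fun x t => (h.2.1 x t).clm L) (ih h.2.2)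

theorem mul {A : Type*} [NormedRing A] [NormedAlgebra ℝ A] {f g : X → I → A}
    (h : JetCont k f) (h' : JetCont k g) : JetCont k fun x t => f x t * g x t :=
  bilin (ContinuousLinearMap.mul ℝ A) h h'

theorem inv {f : X → I → ℝ} (h : JetCont k f) (h0 : ∀ x t, f x t ≠ 0) :
    JetCont k fun x t => (f x t)⁻¹ := by
  induction k with
  | zero => exact h.continuous.inv₀ fun p => h0 p.1 p.2
  | succ k ih =>
    have hi := ih h.pred
    exact succ_of_hasVel (h.continuous.inv₀ fun p => h0 p.1 p.2)
      (fun x t => (h.2.1 x t).inv (h0 x t))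
      (((hi.mul hi).mul h.2.2).clm (-ContinuousLinearMap.id ℝ ℝ))

theorem sqrt {f : X → I → ℝ} (h : JetCont k f) (h0 : ∀ x t, 0 < f x t) :
    JetCont k fun x t => √(f x t) := by
  induction k with
  | zero => exact h.continuous.sqrt
  | succ k ih =>
    refine succ_of_hasVel h.continuous.sqrt (fun x t => (h.2.1 x t).sqrt (h0 x t).ne') ?_
    refine JetCont.mul (JetCont.inv ((JetCont.const 2).mul (ih h.pred)) fun x t => ?_) h.2.2
    have := Real.sqrt_pos.2 (h0 x t)
    positivity

end JetCont

namespace SmoothFamily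

variable {f : X → I → E} {g : X → I → F}

theorem continuous (h : SmoothFamily f) : Continuous fun p : X × I => f p.1 p.2 := h 0

theorem vel (h : SmoothFamily f) : SmoothFamily fun x => vel (f x) := fun k => (h (k + 1)).2.2

theorem hasVel (h : SmoothFamily f) (x : X) (t : I) : HasVel (f x) (SphereCurves.vel (f x) t) t :=
  (h 1).2.1 x t

theorem comp (h : SmoothFamily f) {u : Y → X} (hu : Continuous u) :
    SmoothFamily fun y => f (u y) := fun k => (h k).comp hu

theorem const (c : E) : SmoothFamily fun (_ : X) (_ : I) => c := fun _ => JetCont.const c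

theorem add {g : X → I → E} (h : SmoothFamily f) (h' : SmoothFamily g) :
    SmoothFamily fun x t => f x t + g x t := fun k => (h k).add (h' k)

theorem clm (L : E →L[ℝ] F) (h : SmoothFamily f) : SmoothFamily fun x t => L (f x t) :=
  fun k => (h k).clm L

theorem mul {A : Type*} [NormedRing A] [NormedAlgebra ℝ A] {f g : X → I → A}
    (h : SmoothFamily f) (h' : SmoothFamily g) : SmoothFamily fun x t => f x t * g x t :=
  fun k => (h k).mul (h' k)

theorem smul {f : X → I → ℝ} (h : SmoothFamily f) (h' : SmoothFamily g) :
    SmoothFamily fun x t => f x t • g x t :=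
  fun k => (h k).bilin (ContinuousLinearMap.lsmul ℝ ℝ) (h' k)

theorem inv {f : X → I → ℝ} (h : SmoothFamily f) (h0 : ∀ x t, f x t ≠ 0) :
    SmoothFamily fun x t => (f x t)⁻¹ := fun k => (h k).inv h0

theorem inner {E : Type*} [NormedAddCommGroup E] [InnerProductSpace ℝ E] {f g : X → I → E}
    (h : SmoothFamily f) (h' : SmoothFamily g) :
    SmoothFamily fun x t => inner ℝ (f x t) (g x t) := fun k => (h k).bilin (innerSL ℝ) (h' k)

theorem norm {E : Type*} [NormedAddCommGroup E] [InnerProductSpace ℝ E] {f : X → I → E}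
    (h : SmoothFamily f) (h0 : ∀ x t, f x t ≠ 0) : SmoothFamily fun x t => ‖f x t‖ := by
  have e : (fun x t => ‖f x t‖) = fun x t => √(Inner.inner ℝ (f x t) (f x t)) := by
    ext x t
    exact norm_eq_sqrt_real_inner _
  rw [e]
  exact fun k => (h.inner h k).sqrt fun x t => real_inner_self_pos.2 (h0 x t)

theorem star {f : X → I → Quaternion ℝ} (h : SmoothFamily f) :
    SmoothFamily fun x t => star (f x t) :=
  h.clm quatConj

end SmoothFamily

/-! ### The `C^∞` topology and families with continuous jets -/

theorem derivN_zero (f : I → E) : derivN 0 f = f := by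
  ext t
  simp [derivN]

/-- The `k`-th derivative, peeled off from the inside. -/
theorem derivN_succ (k : ℕ) (f : I → E) : derivN (k + 1) f = derivN k (vel f) := by
  ext t
  rw [derivN, iteratedDerivWithin_succ']
  refine iteratedDerivWithin_congr (fun s hs => ?_) t.2
  rw [Set.IccExtend_of_mem _ _ hs]
  rfl

theorem derivN_one (f : I → E) : derivN 1 f = vel f := by
  rw [derivN_succ, derivN_zero]

theorem contDiffOn_extend_succ {n : ℕ} {f : I → E} :
    ContDiffOn ℝ (n + 1 : ℕ) (Set.IccExtend zero_le_one f) (Icc (0 : ℝ) 1) ↔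
      (∀ t, HasVel f (vel f t) t) ∧
        ContDiffOn ℝ n (Set.IccExtend zero_le_one (vel f)) (Icc (0 : ℝ) 1) := by
  push_cast
  rw [contDiffOn_succ_iff_derivWithin uniqueDiffOn_Icc_zero_one]
  have h1 : DifferentiableOn ℝ (Set.IccExtend zero_le_one f) (Icc (0 : ℝ) 1) ↔
      ∀ t, HasVel f (vel f t) t :=
    ⟨fun h t => (h t t.2).hasDerivWithinAt, fun h t ht => (h ⟨t, ht⟩).differentiableWithinAt⟩
  have h2 : ContDiffOn ℝ n (derivWithin (Set.IccExtend zero_le_one f) (Icc (0 : ℝ) 1))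
        (Icc (0 : ℝ) 1) ↔
      ContDiffOn ℝ n (Set.IccExtend zero_le_one (vel f)) (Icc (0 : ℝ) 1) := by
    refine contDiffOn_congr fun s hs => ?_
    rw [Set.IccExtend_of_mem _ _ hs]
    rfl
  rw [h1, h2]
  simp

theorem JetCont.contDiffOn {k : ℕ} {f : X → I → E} (h : JetCont k f) (x : X) :
    ContDiffOn ℝ k (Set.IccExtend zero_le_one (f x)) (Icc (0 : ℝ) 1) := by
  induction k generalizing f with
  | zero =>
    have : Continuous (f x) := h.continuous.comp (Continuous.prodMk_right x)
    exact contDiffOn_zero.2 (this.Icc_extend' ).continuousOn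
  | succ k ih => exact contDiffOn_extend_succ.2 ⟨h.2.1 x, ih h.2.2⟩

theorem SmoothFamily.contDiffOn {f : X → I → E} (h : SmoothFamily f) (x : X) :
    ContDiffOn ℝ ∞ (Set.IccExtend zero_le_one (f x)) (Icc (0 : ℝ) 1) :=
  contDiffOn_infty.2 fun k => (h k).contDiffOn x

/-- Smooth curves depending on a parameter, as a map into the space of smooth curves. -/
def SmoothFamily.toCurve {f : X → I → E} (h : SmoothFamily f) (x : X) : SmoothCurve E :=
  ⟨f x, h.contDiffOn x⟩

theorem SmoothFamily.continuous_derivN {f : X → I → E} (h : SmoothFamily f) (k : ℕ) :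
    Continuous fun p : X × I => derivN k (f p.1) p.2 := by
  induction k generalizing f with
  | zero =>
    simp only [derivN_zero]
    exact h.continuous
  | succ k ih =>
    simp only [derivN_succ]
    exact ih h.vel

/-- As `[0,1]` is compact, joint continuity of all jets is continuity for the `C^∞` topology. -/
theorem SmoothFamily.continuous_toCurve {f : X → I → E} (h : SmoothFamily f) :
    Continuous h.toCurve := by
  refine continuous_induced_rng.2 (continuous_pi fun k => ?_)
  exact (ContinuousMap.continuous_iff_continuous_uniformFun
    (ContinuousMap.curry ⟨_, h.continuous_derivN k⟩)).1 (ContinuousMap.continuous _)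

theorem continuous_derivN_curve (k : ℕ) :
    Continuous fun p : SmoothCurve E × I => derivN k p.1 p.2 := by
  have hc (γ : SmoothCurve E) : Continuous (derivN k γ) :=
    (γ.smooth.continuousOn_iteratedDerivWithin (by exact_mod_cast le_top)
      uniqueDiffOn_Icc_zero_one).domRestrict
  have h : Continuous fun γ : SmoothCurve E => (⟨derivN k γ, hc γ⟩ : C(I, E)) := by
    rw [ContinuousMap.continuous_iff_continuous_uniformFun]
    have h := continuous_induced_dom (t := inferInstance)
      (f := fun (γ : SmoothCurve E) (k : ℕ) => UniformFun.ofFun (derivN k γ))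
    exact (continuous_apply k).comp h
  exact continuous_eval.comp (h.prodMap continuous_id)

theorem hasVel_derivN (γ : SmoothCurve E) (j : ℕ) (t : I) :
    HasVel (derivN j γ) (derivN (j + 1) γ t) t := by
  have h := (γ.smooth.differentiableOn_iteratedDerivWithin (m := j)
    (by exact_mod_cast WithTop.coe_lt_coe.2 (ENat.natCast_lt_top j))
    uniqueDiffOn_Icc_zero_one t t.2).hasDerivWithinAt
  rw [← iteratedDerivWithin_succ] at h
  refine h.congr (fun s hs => ?_) ?_
  · rw [Set.IccExtend_of_mem _ _ hs]
    rfl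
  · rw [extend_coe]
    rfl

/-- The tautological family of all smooth curves. -/
theorem smoothFamily_curve : SmoothFamily fun γ : SmoothCurve E => γ.toFun := by
  have h (k j : ℕ) : JetCont k fun γ : SmoothCurve E => derivN j γ := by
    induction k generalizing j with
    | zero => exact continuous_derivN_curve j
    | succ k ih =>
      exact JetCont.succ_of_hasVel (continuous_derivN_curve j)
        (fun γ t => hasVel_derivN γ j t) (ih (j + 1))
  intro k
  simpa only [derivN_zero] using h k 0

end Calculus

/-! ### Gram-Schmidt frames and the generalized cross product -/

section Frames

open InnerProductSpace

variable {E : Type*} [NormedAddCommGroup E] [InnerProductSpace ℝ E] {n : ℕ}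

/-- A family that is triangular with respect to an orthonormal family, with non-zero diagonal
coefficients `c j`, has the Gram-Schmidt vectors `c j • e j`. -/
theorem gramSchmidt_eq_of_triangular {f e : Fin n → E} (he : Orthonormal ℝ e) {c : Fin n → ℝ}
    (hc : ∀ j, c j ≠ 0) {a : Fin n → Fin n → ℝ}
    (h : ∀ j, f j = c j • e j + ∑ i ∈ Finset.Iio j, a j i • e i) (j : Fin n) :
    gramSchmidt ℝ f j = c j • e j := by
  induction j using WellFoundedLT.induction with
  | ind j ih =>
    have key : ∀ i ∈ Finset.Iio j, (inner ℝ (gramSchmidt ℝ f i) (f j) /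
        (‖gramSchmidt ℝ f i‖ : ℝ) ^ 2) • gramSchmidt ℝ f i = a j i • e i := by
      intro i hi
      have hij : i < j := Finset.mem_Iio.1 hi
      have h1 : inner ℝ (e i) (f j) = a j i := by
        rw [h j, inner_add_right, he.inner_right_sum _ hi, inner_smul_right, he.2 hij.ne]
        simp
      rw [ih i hij, norm_smul, he.1 i, inner_smul_left, h1, smul_smul]
      have hci := hc i
      congr 1
      simp
      field_simp
    have h2 := gramSchmidt_def'' ℝ f j
    simp only [RCLike.ofReal_real_eq_id, id_eq] at h2
    rw [Finset.sum_congr rfl key, h j] at h2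
    exact (add_right_cancel h2).symm

theorem gramSchmidtNormed_eq_of_triangular {f e : Fin n → E} (he : Orthonormal ℝ e)
    {c : Fin n → ℝ} (hc : ∀ j, 0 < c j) {a : Fin n → Fin n → ℝ}
    (h : ∀ j, f j = c j • e j + ∑ i ∈ Finset.Iio j, a j i • e i) :
    gramSchmidtNormed ℝ f = e := by
  ext j
  rw [gramSchmidtNormed, gramSchmidt_eq_of_triangular he (fun j => (hc j).ne') h j, norm_smul,
    he.1 j, mul_one, Real.norm_of_nonneg (hc j).le, smul_smul]
  simp [(hc j).ne']

theorem linearIndependent_of_triangular {f e : Fin n → E} (he : Orthonormal ℝ e) {c : Fin n → ℝ}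
    (hc : ∀ j, c j ≠ 0) {a : Fin n → Fin n → ℝ}
    (h : ∀ j, f j = c j • e j + ∑ i ∈ Finset.Iio j, a j i • e i) :
    LinearIndependent ℝ f := by
  have hg : LinearIndependent ℝ (gramSchmidt ℝ f) := by
    refine linearIndependent_of_ne_zero_of_inner_eq_zero (fun j => ?_)
      (gramSchmidt_pairwise_orthogonal ℝ f)
    rw [gramSchmidt_eq_of_triangular he hc h j]
    exact smul_ne_zero (hc j) (he.ne_zero j)
  rw [linearIndependent_iff_card_eq_finrank_span] at hg ⊢
  rw [hg, Set.finrank, Set.finrank, span_gramSchmidt]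

theorem eq_gramSchmidtNormed_add_sum (f : Fin n → E) (j : Fin n) :
    f j = ‖gramSchmidt ℝ f j‖ • gramSchmidtNormed ℝ f j +
      ∑ i ∈ Finset.Iio j,
        inner ℝ (gramSchmidtNormed ℝ f i) (f j) • gramSchmidtNormed ℝ f i := by
  have e (i : Fin n) : ‖gramSchmidt ℝ f i‖ • gramSchmidtNormed ℝ f i = gramSchmidt ℝ f i := by
    rcases eq_or_ne (gramSchmidt ℝ f i) 0 with h0 | h0
    · simp [h0]
    · simp [gramSchmidtNormed, smul_smul, norm_ne_zero_iff.2 h0]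
  rw [e]
  conv_lhs => rw [gramSchmidt_def'' ℝ f j]
  refine congrArg _ (Finset.sum_congr rfl fun i _ => ?_)
  rw [gramSchmidtNormed, inner_smul_left, smul_smul]
  congr 1
  simp
  ring

/-- The generalized cross product of the first `n` columns of a special orthogonal matrix is the
last column. -/
theorem cross_of_specialOrthogonal {u : Fin (n + 1) → Euc (n + 1)}
    (hu : Orthonormal ℝ u) (hdet : (Matrix.of fun i j => u j i).det = 1) :
    cross (fun j : Fin n => u j.castSucc) = u (Fin.last n) := by
  set M : Matrix (Fin (n + 1)) (Fin (n + 1)) ℝ := Matrix.of fun i j => u j i with hM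
  have hMM : M.transpose * M = 1 := by
    ext i j
    have := orthonormal_iff_ite.1 hu i j
    rw [PiLp.inner_apply] at this
    simpa [Matrix.mul_apply, hM, Matrix.one_apply, mul_comm] using this
  -- the cross product is a row of the adjugate, which for `M ∈ SO` is the transpose
  have hadj : M.adjugate = M.transpose := by
    have h := congrArg (· * M.adjugate) hMM
    simpa [Matrix.mul_assoc, Matrix.mul_adjugate, hdet] using h.symm
  refine PiLp.ext fun i => ?_
  have h2 := congrFun (congrFun hadj (Fin.last n)) i
  rw [Matrix.transpose_apply, ← Matrix.transpose_apply M.adjugate, Matrix.adjugate_transpose,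
    Matrix.adjugate_apply] at h2
  rw [hM, Matrix.of_apply] at h2
  rw [← h2, ← Matrix.det_transpose]
  refine congrArg Matrix.det (Matrix.ext fun a b => ?_)
  refine Fin.lastCases ?_ (fun b => ?_) b
  · simp [Matrix.updateRow_apply, Pi.single_apply]
  · simp [Matrix.updateRow_apply]

/-- The Frenet frame of a curve is the special orthogonal frame `u` as soon as the derivatives of
the curve are triangular in `u`, with positive diagonal coefficients. -/
theorem frenetVec_eq_of_triangular {γ : SmoothCurve (Euc (n + 1))} {t : I}
    {u : Fin (n + 1) → Euc (n + 1)}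
    (hu : Orthonormal ℝ u) (hdet : (Matrix.of fun i j => u j i).det = 1)
    {c : Fin n → ℝ} (hc : ∀ j, 0 < c j) {a : Fin n → Fin n → ℝ}
    (h : ∀ j : Fin n, derivN j γ t =
      c j • u j.castSucc + ∑ i ∈ Finset.Iio j, a j i • u i.castSucc) :
    frenetVec γ t = u := by
  have he : Orthonormal ℝ fun j : Fin n => u j.castSucc :=
    hu.comp _ (Fin.castSucc_injective n)
  have hg := gramSchmidtNormed_eq_of_triangular (f := fun j : Fin n => derivN j γ t) he hc h
  rw [frenetVec, hg, cross_of_specialOrthogonal hu hdet]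
  exact Fin.snoc_init_self u

theorem frenetVec_castSucc (γ : SmoothCurve (Euc (n + 1))) (t : I) (j : Fin n) :
    frenetVec γ t j.castSucc = gramSchmidtNormed ℝ (fun j : Fin n => derivN j γ t) j := by
  simp [frenetVec]

/-- The derivatives of a generic curve are triangular in its Frenet frame, with positive diagonal
coefficients. -/
theorem IsGeneric.derivN_eq {γ : SmoothCurve (Euc (n + 1))} (hγ : IsGeneric γ) (t : I)
    (j : Fin n) : ∃ c : ℝ, 0 < c ∧ derivN j γ t = c • frenetVec γ t j.castSucc +
      ∑ i ∈ Finset.Iio j,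
        inner ℝ (frenetVec γ t i.castSucc) (derivN j γ t) • frenetVec γ t i.castSucc := by
  refine ⟨_, norm_pos_iff.2 (gramSchmidt_ne_zero j (hγ.2 t)), ?_⟩
  simp only [frenetVec_castSucc]
  exact eq_gramSchmidtNormed_add_sum (fun j : Fin n => derivN j γ t) j

end Frames

/-! ### Frames from unit quaternions -/

section Spin

/-- The linear isometry between the quaternions and `ℝ⁴`, in the basis `1, 𝐢, 𝐣, 𝐤`. -/
noncomputable abbrev quatEquiv : Quaternion ℝ ≃ₗᵢ[ℝ] Euc (3 + 1) :=
  Quaternion.linearIsometryEquivTuple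

@[simp] theorem re_unitQ (j : Fin 4) : (unitQ j).re = ![1, 0, 0, 0] j := by
  fin_cases j <;> rfl

@[simp] theorem imI_unitQ (j : Fin 4) : (unitQ j).imI = ![0, 1, 0, 0] j := by
  fin_cases j <;> rfl

@[simp] theorem imJ_unitQ (j : Fin 4) : (unitQ j).imJ = ![0, 0, 1, 0] j := by
  fin_cases j <;> rfl

@[simp] theorem imK_unitQ (j : Fin 4) : (unitQ j).imK = ![0, 0, 0, 1] j := by
  fin_cases j <;> rfl

/-- The isometric embedding of `ℝ³` as the imaginary quaternions. -/
noncomputable def imEmb : Euc (2 + 1) →ₗᵢ[ℝ] Quaternion ℝ where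
  toFun x := x 0 • unitQ 1 + x 1 • unitQ 2 + x 2 • unitQ 3
  map_add' x y := by ext <;> simp
  map_smul' r x := by ext <;> simp
  norm_map' x := by
    rw [← sq_eq_sq₀ (norm_nonneg _) (norm_nonneg _), EuclideanSpace.real_norm_sq_eq, sq,
      ← Quaternion.normSq_eq_norm_mul_self, Quaternion.normSq_def']
    change _ = ∑ i : Fin 3, _
    simp [Fin.sum_univ_three]

/-- The imaginary part of a quaternion as a vector of `ℝ³`. -/
noncomputable def imProj : Quaternion ℝ →L[ℝ] Euc (2 + 1) :=
  LinearMap.toContinuousLinearMap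
    { toFun := fun q => !₂[q.imI, q.imJ, q.imK]
      map_add' := fun p q => by ext i; fin_cases i <;> simp
      map_smul' := fun r q => by ext i; fin_cases i <;> simp }

theorem imProj_apply (q : Quaternion ℝ) : imProj q = !₂[q.imI, q.imJ, q.imK] := rfl

theorem imEmb_apply (x : Euc (2 + 1)) :
    imEmb x = x 0 • unitQ 1 + x 1 • unitQ 2 + x 2 • unitQ 3 := rfl

theorem imEmb_imProj {q : Quaternion ℝ} (h : q.re = 0) : imEmb (imProj q) = q := by
  ext <;> simp [imProj_apply, imEmb_apply, h]

theorem star_imEmb (x : Euc (2 + 1)) : star (imEmb x) = -imEmb x := by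
  ext <;> simp [imEmb_apply]

theorem orthonormal_unitQ : Orthonormal ℝ unitQ := by
  rw [orthonormal_iff_ite]
  intro i j
  rw [Quaternion.inner_def]
  fin_cases i <;> fin_cases j <;> simp

theorem star_mul_self_spin (z : Spin3) : star (z : Quaternion ℝ) * z = 1 := by
  have h : ‖(z : Quaternion ℝ)‖ = 1 := by simp
  rw [Quaternion.star_mul_self, Quaternion.normSq_eq_norm_mul_self, h]
  simp

theorem self_mul_star_spin (z : Spin3) : (z : Quaternion ℝ) * star (z : Quaternion ℝ) = 1 := by
  have h : ‖(z : Quaternion ℝ)‖ = 1 := by simp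
  rw [Quaternion.self_mul_star, Quaternion.normSq_eq_norm_mul_self, h]
  simp

theorem norm_spin (z : Spin3) : ‖(z : Quaternion ℝ)‖ = 1 := by simp

theorem sum_sq_spin (z : Spin3) :
    (z : Quaternion ℝ).re ^ 2 + (z : Quaternion ℝ).imI ^ 2 + (z : Quaternion ℝ).imJ ^ 2 +
      (z : Quaternion ℝ).imK ^ 2 = 1 := by
  rw [← Quaternion.normSq_def', Quaternion.normSq_eq_norm_mul_self, norm_spin, one_mul]

/-- The isometry `q ↦ a q b̄` of the quaternions given by two unit quaternions `a, b`. -/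
noncomputable def spinIso (a b : Spin3) : Quaternion ℝ →ₗᵢ[ℝ] Quaternion ℝ where
  toFun q := a * q * star (b : Quaternion ℝ)
  map_add' p q := by noncomm_ring
  map_smul' r q := by simp
  norm_map' q := by simp

theorem spinIso_apply (a b : Spin3) (q : Quaternion ℝ) :
    spinIso a b q = a * q * star (b : Quaternion ℝ) := rfl

theorem spinIso_mul_star (a b : Spin3) (p q : Quaternion ℝ) :
    spinIso a b p * star (spinIso a b q) = spinIso a a (p * star q) := by
  simp only [spinIso_apply, star_mul, star_star]
  calc _ = (a : Quaternion ℝ) * p * (star (b : Quaternion ℝ) * b) *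
          (star q * star (a : Quaternion ℝ)) := by
        noncomm_ring
    _ = _ := by rw [star_mul_self_spin]; noncomm_ring

theorem star_spinIso_mul (a b : Spin3) (p q : Quaternion ℝ) :
    star (spinIso a b p) * spinIso a b q = spinIso b b (star p * q) := by
  simp only [spinIso_apply, star_mul, star_star]
  calc _ = (b : Quaternion ℝ) * star p * (star (a : Quaternion ℝ) * a) *
          (q * star (b : Quaternion ℝ)) := by
        noncomm_ring
    _ = _ := by rw [star_mul_self_spin]; noncomm_ring

theorem spinIso_mul (a b c : Spin3) (p q : Quaternion ℝ) :
    spinIso a b p * spinIso b c q = spinIso a c (p * q) := by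
  simp only [spinIso_apply]
  calc _ = (a : Quaternion ℝ) * p * (star (b : Quaternion ℝ) * b) *
          (q * star (c : Quaternion ℝ)) := by
        noncomm_ring
    _ = _ := by rw [star_mul_self_spin]; noncomm_ring

theorem re_spinIso_self (a : Spin3) (q : Quaternion ℝ) : (spinIso a a q).re = q.re := by
  have h := sum_sq_spin a
  simp [spinIso_apply]
  linear_combination q.re * h

/-- The columns of the matrix `Π₃ z`. -/
noncomputable def frame3 (z : Spin3) (j : Fin (2 + 1)) : Euc (2 + 1) :=
  imProj (spinIso z z (unitQ j.succ))

/-- The columns of the matrix `Π₄ z`. -/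
noncomputable def frame4 (z : Spin4) (j : Fin (3 + 1)) : Euc (3 + 1) :=
  quatEquiv (spinIso z.1 z.2 (unitQ j))

theorem re_unitQ_succ (j : Fin 3) : (unitQ j.succ).re = 0 := by
  fin_cases j <;> rfl

theorem imEmb_frame3 (z : Spin3) (j : Fin (2 + 1)) :
    imEmb (frame3 z j) = spinIso z z (unitQ j.succ) :=
  imEmb_imProj (by rw [re_spinIso_self, re_unitQ_succ])

theorem orthonormal_frame3 (z : Spin3) : Orthonormal ℝ (frame3 z) := by
  rw [← imEmb.orthonormal_comp_iff]
  have e : imEmb ∘ frame3 z = spinIso z z ∘ fun j : Fin 3 => unitQ j.succ :=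
    funext fun j => imEmb_frame3 z j
  rw [e, (spinIso z z).orthonormal_comp_iff]
  exact orthonormal_unitQ.comp _ (Fin.succ_injective 3)

theorem orthonormal_frame4 (z : Spin4) : Orthonormal ℝ (frame4 z) :=
  (orthonormal_unitQ.comp_linearIsometry (spinIso z.1 z.2)).comp_linearIsometry
    quatEquiv.toLinearIsometry

theorem Pi3_eq (z : Spin3) : Pi3 z = Matrix.of fun i j => frame3 z j i := by
  ext i j
  fin_cases i <;> rfl

theorem Pi4_eq (z : Spin4) : Pi4 z = Matrix.of fun i j => frame4 z j i := by
  ext i j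
  fin_cases i <;> rfl

theorem det_Pi3 (z : Spin3) : (Pi3 z).det = 1 := by
  have h := sum_sq_spin z
  have e : (Pi3 z).det = ((z : Quaternion ℝ).re ^ 2 + (z : Quaternion ℝ).imI ^ 2 +
      (z : Quaternion ℝ).imJ ^ 2 + (z : Quaternion ℝ).imK ^ 2) ^ 3 := by
    rw [Matrix.det_fin_three]
    simp [Pi3, coords]
    ring
  rw [e, h, one_pow]

theorem coords_mul (z q : Quaternion ℝ) (i : Fin 4) :
    coords (z * q) i = ∑ k, coords (z * unitQ k) i * coords q k := by
  fin_cases i <;> simp [coords, Fin.sum_univ_four] <;> ring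

theorem det_leftMul (a b c d : ℝ) :
    (!![a, -b, -c, -d; b, a, -d, c; c, d, a, -b; d, -c, b, a]).det =
      (a ^ 2 + b ^ 2 + c ^ 2 + d ^ 2) ^ 2 := by
  simp [Matrix.det_succ_row_zero, Fin.sum_univ_succ, Fin.succAbove]
  ring

theorem det_rightMul (a b c d : ℝ) :
    (!![a, b, c, d; -b, a, -d, c; -c, d, a, -b; -d, -c, b, a]).det =
      (a ^ 2 + b ^ 2 + c ^ 2 + d ^ 2) ^ 2 := by
  simp [Matrix.det_succ_row_zero, Fin.sum_univ_succ, Fin.succAbove]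
  ring

/-- `Π₄ z` is a left times a right translation, both of determinant one. -/
theorem det_Pi4 (z : Spin4) : (Pi4 z).det = 1 := by
  have e : Pi4 z =
      (Matrix.of fun i j => coords ((z.1 : Quaternion ℝ) * unitQ j) i) *
        Matrix.of fun i j => coords (unitQ j * star (z.2 : Quaternion ℝ)) i := by
    ext i j
    rw [Pi4, Matrix.of_apply, mul_assoc, coords_mul]
    rfl
  have e1 : (Matrix.of fun i j => coords ((z.1 : Quaternion ℝ) * unitQ j) i).det = 1 := by
    refine Eq.trans ?_ ((det_leftMul _ _ _ _).trans
      ((congrArg (· ^ 2) (sum_sq_spin z.1)).trans (one_pow 2)))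
    refine congrArg Matrix.det ?_
    ext i j
    fin_cases i <;> fin_cases j <;> simp [coords]
  have e2 : (Matrix.of fun i j => coords (unitQ j * star (z.2 : Quaternion ℝ)) i).det = 1 := by
    refine Eq.trans ?_ ((det_rightMul _ _ _ _).trans
      ((congrArg (· ^ 2) (sum_sq_spin z.2)).trans (one_pow 2)))
    refine congrArg Matrix.det ?_
    ext i j
    fin_cases i <;> fin_cases j <;> simp [coords]
  rw [e, Matrix.det_mul, e1, e2, one_mul]

theorem Pi3_eq_frenetFrame_iff {γ : SmoothCurve (Euc (2 + 1))} {t : I} {z : Spin3} :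
    Pi3 z = frenetFrame γ t ↔ frenetVec γ t = frame3 z := by
  rw [Pi3_eq, frenetFrame]
  refine ⟨fun h => ?_, fun h => by rw [h]⟩
  ext j i
  exact (congrFun (congrFun h i) j).symm

theorem Pi4_eq_frenetFrame_iff {γ : SmoothCurve (Euc (3 + 1))} {t : I} {z : Spin4} :
    Pi4 z = frenetFrame γ t ↔ frenetVec γ t = frame4 z := by
  rw [Pi4_eq, frenetFrame]
  refine ⟨fun h => ?_, fun h => by rw [h]⟩
  ext j i
  exact (congrFun (congrFun h i) j).symm

/-! ### Recovering a unit quaternion from the rotation it covers -/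

/-- Averaging `q ↦ e q ē` over the basis `1, 𝐢, 𝐣, 𝐤` projects onto the real part. Hence a unit
quaternion is recovered, up to the scalar `4 ⟪w, c⟫`, from its rotation. -/
theorem sum_conj_unitQ (w c : Quaternion ℝ) :
    w * star w * c + ∑ j : Fin 3, w * unitQ j.succ * star w * c * star (unitQ j.succ) =
      (4 * inner ℝ w c) • w := by
  ext <;> simp [Fin.sum_univ_three, Quaternion.inner_def] <;> ring

/-- Unit quaternions covering the same rotation are proportional. -/
theorem eq_inner_smul_of_frame3_eq {z z' : Spin3} (h : frame3 z = frame3 z') :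
    (z' : Quaternion ℝ) = inner ℝ (z : Quaternion ℝ) (z' : Quaternion ℝ) • (z : Quaternion ℝ) := by
  have hj (j : Fin 3) : (z : Quaternion ℝ) * unitQ j.succ * star (z : Quaternion ℝ) =
      z' * unitQ j.succ * star (z' : Quaternion ℝ) := by
    rw [← spinIso_apply, ← spinIso_apply, ← imEmb_frame3 z, ← imEmb_frame3 z', h]
  have h1 := sum_conj_unitQ z z'
  have h2 := sum_conj_unitQ z' z'
  simp only [hj, self_mul_star_spin] at h1
  rw [self_mul_star_spin, h1, real_inner_self_eq_norm_sq, norm_spin, mul_smul, mul_smul] at h2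
  have h4 := smul_right_injective (Quaternion ℝ) (four_ne_zero (α := ℝ)) h2
  simpa using h4.symm

/-- Lifted frames of a curve on `𝕊²` are unique: the inner product of two of them takes the values
`±1`, and is `1` at the start. -/
theorem IsLiftedFrame.unique {γ : SmoothCurve (Euc (2 + 1))} {w w' : C(I, Spin3)}
    (h : IsLiftedFrame Pi3 γ w) (h' : IsLiftedFrame Pi3 γ w') : w = w' := by
  have hf (t : I) : frame3 (w t) = frame3 (w' t) := by
    rw [← Pi3_eq_frenetFrame_iff.1 (h.2 t), ← Pi3_eq_frenetFrame_iff.1 (h'.2 t)]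
  set f : I → ℝ := fun t => inner ℝ (w t : Quaternion ℝ) (w' t : Quaternion ℝ) with hfdef
  have hcont : Continuous f :=
    (continuous_subtype_val.comp w.continuous).inner (continuous_subtype_val.comp w'.continuous)
  have hsq (t : I) : f t = 1 ∨ f t = -1 := by
    have := congrArg norm (eq_inner_smul_of_frame3_eq (hf t))
    rw [norm_smul, norm_spin, norm_spin, mul_one, Real.norm_eq_abs] at this
    exact (abs_eq zero_le_one).1 this.symm
  have h0 : f 0 = 1 := by
    simp [hfdef, h.1, h'.1]
  have h1 (t : I) : f t = 1 := by
    rcases isPreconnected_univ.eq_or_eq_neg_of_sq_eq hcont.continuousOn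
      (continuousOn_const (c := (1 : ℝ))) (fun s _ => by rcases hsq s with e | e <;> simp [e])
      (by simp) with e | e
    · exact e (mem_univ t)
    · have := e (mem_univ 0)
      simp [h0] at this
      norm_num at this
  ext1 t
  have := eq_inner_smul_of_frame3_eq (hf t)
  apply Subtype.ext
  rw [this]
  change _ = f t • _
  rw [h1, one_smul]

end Spin

/-! ### Frenet equations -/

section FrenetEquations

variable {E : Type*} [NormedAddCommGroup E] [InnerProductSpace ℝ E] {n : ℕ}

/-- Differentiating a constant inner product. -/
theorem inner_vel_add_inner_vel {f g : I → E} {f' g' : E} {t : I} {c : ℝ}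
    (h : ∀ s, inner ℝ (f s) (g s) = c) (hf : HasVel f f' t) (hg : HasVel g g' t) :
    inner ℝ f' (g t) + inner ℝ (f t) g' = 0 := by
  have h1 := hf.inner hg
  simp only [h] at h1
  exact h1.unique (HasVel.const c t)

theorem eq_sum_inner_smul {m : ℕ} {e : Fin m → Euc m} (he : Orthonormal ℝ e)
    (x : Euc m) : x = ∑ j, inner ℝ (e j) x • e j := by
  have hs := (he.linearIndependent.span_eq_top_of_card_eq_finrank' (by simp)).ge
  have h := (OrthonormalBasis.mk he hs).sum_repr' x
  simpa using h.symm

theorem SmoothCurve.hasVel (γ : SmoothCurve E) (t : I) : HasVel γ (vel γ t) t :=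
  smoothFamily_curve.hasVel γ t

theorem IsGeneric.norm_frenetVec {γ : SmoothCurve (Euc (n + 1))} (hγ : IsGeneric γ) (t : I)
    (j : Fin n) : ‖frenetVec γ t j.castSucc‖ = 1 := by
  rw [frenetVec_castSucc]
  exact InnerProductSpace.gramSchmidtNormed_unit_length j (hγ.2 t)

theorem IsGeneric.frenetVec_position {γ : SmoothCurve (Euc (n + 1))} (hγ : IsGeneric γ) (t : I)
    {j : Fin n} (hj : (j : ℕ) = 0) : frenetVec γ t j.castSucc = γ t := by
  obtain ⟨c, hc, h⟩ := hγ.derivN_eq t j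
  have he : Finset.Iio j = ∅ := by
    ext i
    simp only [Finset.mem_Iio, Fin.lt_def, hj]
    simp
  rw [he, Finset.sum_empty, add_zero, hj, derivN_zero] at h
  have hn := congrArg norm h
  rw [norm_smul, hγ.norm_frenetVec, hγ.1, mul_one, Real.norm_of_nonneg hc.le] at hn
  rw [h, ← hn, one_smul]

theorem IsGeneric.inner_vel {γ : SmoothCurve (Euc (n + 1))} (hγ : IsGeneric γ) (t : I) :
    inner ℝ (γ t) (vel γ t) = 0 := by
  have h := inner_vel_add_inner_vel (f := γ) (g := γ) (c := 1)
    (fun s => by rw [real_inner_self_eq_norm_sq, hγ.1, one_pow]) (γ.hasVel t) (γ.hasVel t)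
  rw [real_inner_comm] at h
  linarith

theorem IsGeneric.frenetVec_tangent {γ : SmoothCurve (Euc (n + 1))} (hγ : IsGeneric γ) (t : I)
    {j : Fin n} (hj : (j : ℕ) = 1) :
    0 < ‖vel γ t‖ ∧ frenetVec γ t j.castSucc = unitTangent γ t := by
  obtain ⟨c, hc, h⟩ := hγ.derivN_eq t j
  have hn0 : 0 < n := by omega
  have he : Finset.Iio j = {⟨0, hn0⟩} := by
    ext i
    simp only [Finset.mem_Iio, Fin.lt_def, hj, Finset.mem_singleton, Fin.ext_iff]
    omega
  rw [he, Finset.sum_singleton, hγ.frenetVec_position t (j := ⟨0, hn0⟩) rfl, hj, derivN_one,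
    hγ.inner_vel, zero_smul, add_zero] at h
  have hn : ‖vel γ t‖ = c := by
    rw [h, norm_smul, hγ.norm_frenetVec, mul_one, Real.norm_of_nonneg hc.le]
  refine ⟨hn ▸ hc, ?_⟩
  rw [unitTangent, hn, h, smul_smul, inv_mul_cancel₀ hc.ne', one_smul]

theorem norm_smul_unitTangent (γ : SmoothCurve (Euc (n + 1))) (t : I) :
    ‖vel γ t‖ • unitTangent γ t = vel γ t := by
  rcases eq_or_ne (vel γ t) 0 with h | h
  · simp [h]
  · rw [unitTangent, smul_smul, mul_inv_cancel₀ (norm_ne_zero_iff.2 h), one_smul]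

section Families

variable {X : Type*} [TopologicalSpace X] {c : X → SmoothCurve (Euc (n + 1))}

theorem smoothFamily_vel (hc : Continuous c) : SmoothFamily fun x => vel (c x) :=
  (smoothFamily_curve.comp hc).vel

theorem smoothFamily_speed (hc : Continuous c) (h0 : ∀ x t, 0 < ‖vel (c x) t‖) :
    SmoothFamily fun x t => ‖vel (c x) t‖ :=
  (smoothFamily_vel hc).norm fun x t => norm_pos_iff.1 (h0 x t)

theorem smoothFamily_unitTangent (hc : Continuous c) (h0 : ∀ x t, 0 < ‖vel (c x) t‖) :
    SmoothFamily fun x => unitTangent (c x) :=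
  ((smoothFamily_speed hc h0).inv fun x t => (h0 x t).ne').smul (smoothFamily_vel hc)

end Families

/-! ### Curves on `𝕊²` -/

section Two

variable {γ : SmoothCurve (Euc (2 + 1))}

theorem IsGeneric.frenetVec_zero2 (hγ : IsGeneric γ) (t : I) : frenetVec γ t 0 = γ t :=
  hγ.frenetVec_position t (j := 0) rfl

theorem IsGeneric.frenetVec_one2 (hγ : IsGeneric γ) (t : I) :
    frenetVec γ t 1 = unitTangent γ t :=
  (hγ.frenetVec_tangent t (j := 1) rfl).2

theorem IsGeneric.speed_pos2 (hγ : IsGeneric γ) (t : I) : 0 < ‖vel γ t‖ :=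
  (hγ.frenetVec_tangent t (j := 1) rfl).1

/-- The Frenet equation for the tangent of a generic curve on `𝕊²`. -/
theorem vel_unitTangent2 (hγ : IsGeneric γ) (ho : ∀ t, Orthonormal ℝ (frenetVec γ t)) {t : I}
    (hT : HasVel (unitTangent γ) (vel (unitTangent γ) t) t) :
    vel (unitTangent γ) t =
      ‖vel γ t‖ • (-γ t + geodCurv γ t • frenetVec γ t 2) := by
  set s := ‖vel γ t‖ with hs
  have hs0 : 0 < s := hγ.speed_pos2 t
  have o (t : I) (i j : Fin (2 + 1)) := orthonormal_iff_ite.1 (ho t) i j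
  have h0 := inner_vel_add_inner_vel (f := γ) (g := unitTangent γ) (c := 0) (fun r => by
    have := o r 0 1
    rwa [hγ.frenetVec_zero2, hγ.frenetVec_one2] at this) (γ.hasVel t) hT
  have h1 := inner_vel_add_inner_vel (f := unitTangent γ) (g := unitTangent γ) (c := 1)
    (fun r => by
      have := o r 1 1
      rwa [hγ.frenetVec_one2] at this) hT hT
  have h11 : inner ℝ (unitTangent γ t) (unitTangent γ t) = 1 := by
    have := o t 1 1
    rwa [hγ.frenetVec_one2] at this
  rw [← norm_smul_unitTangent, inner_smul_left, h11, ← hs] at h0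
  rw [real_inner_comm] at h1
  have h2 : inner ℝ (frenetVec γ t 2) (vel (unitTangent γ) t) = s * geodCurv γ t := by
    rw [geodCurv, real_inner_comm, ← hs, mul_div_cancel₀ _ hs0.ne']
  have h := eq_sum_inner_smul (ho t) (vel (unitTangent γ) t)
  have e : inner ℝ (γ t) (vel (unitTangent γ) t) = -s := by
    simp at h0
    linarith
  have e1 : inner ℝ (unitTangent γ t) (vel (unitTangent γ) t) = 0 := by linarith
  rw [Fin.sum_univ_three, hγ.frenetVec_zero2, hγ.frenetVec_one2, e, e1, h2] at h
  rw [h]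
  module

end Two

/-! ### Curves on `𝕊³` -/

section Three

variable {γ : SmoothCurve (Euc (3 + 1))}

theorem IsGeneric.frenetVec_zero3 (hγ : IsGeneric γ) (t : I) : frenetVec γ t 0 = γ t :=
  hγ.frenetVec_position t (j := 0) rfl

theorem IsGeneric.frenetVec_one3 (hγ : IsGeneric γ) (t : I) :
    frenetVec γ t 1 = unitTangent γ t :=
  (hγ.frenetVec_tangent t (j := 1) rfl).2

theorem IsGeneric.speed_pos3 (hγ : IsGeneric γ) (t : I) : 0 < ‖vel γ t‖ :=
  (hγ.frenetVec_tangent t (j := 1) rfl).1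

/-- The Frenet equation for the tangent of a generic curve on `𝕊³`. -/
theorem vel_unitTangent3 (hγ : IsGeneric γ) (ho : ∀ t, Orthonormal ℝ (frenetVec γ t)) {t : I}
    (hv : HasVel (fun t => ‖vel γ t‖) (vel (fun t => ‖vel γ t‖) t) t)
    (hT : HasVel (unitTangent γ) (vel (unitTangent γ) t) t) :
    0 < geodCurv γ t ∧ vel (unitTangent γ) t =
      ‖vel γ t‖ • (-γ t + geodCurv γ t • frenetVec γ t 2) := by
  set s := ‖vel γ t‖ with hs
  have hs0 : 0 < s := hγ.speed_pos3 t
  have o (t : I) (i j : Fin (3 + 1)) := orthonormal_iff_ite.1 (ho t) i j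
  have h0 := inner_vel_add_inner_vel (f := γ) (g := unitTangent γ) (c := 0) (fun r => by
    have := o r 0 1
    rwa [hγ.frenetVec_zero3, hγ.frenetVec_one3] at this) (γ.hasVel t) hT
  have h1 := inner_vel_add_inner_vel (f := unitTangent γ) (g := unitTangent γ) (c := 1)
    (fun r => by
      have := o r 1 1
      rwa [hγ.frenetVec_one3] at this) hT hT
  have h11 : inner ℝ (unitTangent γ t) (unitTangent γ t) = 1 := by
    have := o t 1 1
    rwa [hγ.frenetVec_one3] at this
  rw [← norm_smul_unitTangent, inner_smul_left, h11, ← hs] at h0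
  rw [real_inner_comm] at h1
  have h2 : inner ℝ (frenetVec γ t 2) (vel (unitTangent γ) t) = s * geodCurv γ t := by
    rw [geodCurv, real_inner_comm, ← hs, mul_div_cancel₀ _ hs0.ne']
  have e : inner ℝ (γ t) (vel (unitTangent γ) t) = -s := by
    simp at h0
    linarith
  have e1 : inner ℝ (unitTangent γ t) (vel (unitTangent γ) t) = 0 := by linarith
  -- the second derivative, computed from `γ' = ‖γ'‖ 𝐭`
  have hacc : derivN 2 γ t = vel (fun t => ‖vel γ t‖) t • frenetVec γ t 1 +
      s • vel (unitTangent γ) t := by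
    have e : vel γ = fun r => ‖vel γ r‖ • unitTangent γ r :=
      funext fun r => (norm_smul_unitTangent γ r).symm
    rw [derivN_succ, derivN_one, hγ.frenetVec_one3]
    conv_lhs => rw [e]
    exact (hv.smul hT).vel_eq
  obtain ⟨c, hc, hd⟩ := hγ.derivN_eq t 2
  have hIio : Finset.Iio (2 : Fin 3) = {0, 1} := by decide
  rw [hIio, Finset.sum_pair (by decide)] at hd
  change derivN 2 γ t = c • frenetVec γ t 2 + (_ • frenetVec γ t 0 + _ • frenetVec γ t 1) at hd
  have h3 : inner ℝ (frenetVec γ t 3) (vel (unitTangent γ) t) = 0 := by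
    have hL := congrArg (inner ℝ (frenetVec γ t 3)) hacc
    rw [hd] at hL
    simp only [inner_add_right, inner_smul_right, o] at hL
    simpa [hs0.ne'] using hL
  have h4 : c = s * (s * geodCurv γ t) := by
    have hL := congrArg (inner ℝ (frenetVec γ t 2)) hacc
    rw [hd] at hL
    simp only [inner_add_right, inner_smul_right, o, h2] at hL
    simpa using hL
  refine ⟨?_, ?_⟩
  · rw [h4] at hc
    exact pos_of_mul_pos_right (pos_of_mul_pos_right hc hs0.le) hs0.le
  · have h := eq_sum_inner_smul (ho t) (vel (unitTangent γ) t)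
    rw [Fin.sum_univ_four, hγ.frenetVec_zero3, hγ.frenetVec_one3, e, e1, h2, h3] at h
    rw [h]
    module

/-- The Frenet equation for the normal of a generic curve on `𝕊³`. -/
theorem vel_normal3 (hγ : IsGeneric γ) (ho : ∀ t, Orthonormal ℝ (frenetVec γ t)) {t : I}
    (hT : HasVel (unitTangent γ) (vel (unitTangent γ) t) t)
    (hN : HasVel (fun s => frenetVec γ s 2) (vel (fun s => frenetVec γ s 2) t) t)
    (hB : HasVel (fun s => frenetVec γ s 3) (vel (fun s => frenetVec γ s 3) t) t) :
    vel (fun s => frenetVec γ s 2) t =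
      ‖vel γ t‖ • (-(geodCurv γ t • frenetVec γ t 1) + geodTors γ t • frenetVec γ t 3) := by
  set s := ‖vel γ t‖ with hs
  have hs0 : 0 < s := hγ.speed_pos3 t
  have o (t : I) (i j : Fin (3 + 1)) := orthonormal_iff_ite.1 (ho t) i j
  have h0 := inner_vel_add_inner_vel (f := γ) (g := fun s => frenetVec γ s 2) (c := 0)
    (fun r => by
      have := o r 0 2
      rwa [hγ.frenetVec_zero3] at this) (γ.hasVel t) hN
  have h1 := inner_vel_add_inner_vel (f := unitTangent γ) (g := fun s => frenetVec γ s 2) (c := 0)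
    (fun r => by
      have := o r 1 2
      rwa [hγ.frenetVec_one3] at this) hT hN
  have h2 := inner_vel_add_inner_vel (c := 1) (fun r => o r 2 2) hN hN
  have h3 := inner_vel_add_inner_vel (c := 0) (fun r => o r 3 2) hB hN
  rw [← norm_smul_unitTangent, ← hγ.frenetVec_one3, inner_smul_left, o] at h0
  rw [← hγ.frenetVec_one3] at h1
  rw [real_inner_comm] at h2
  have k : inner ℝ (vel (unitTangent γ) t) (frenetVec γ t 2) = s * geodCurv γ t := by
    rw [geodCurv, ← hs, mul_div_cancel₀ _ hs0.ne']
  have k' : inner ℝ (vel (fun s => frenetVec γ s 3) t) (frenetVec γ t 2) = -(s * geodTors γ t) := by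
    rw [geodTors, ← hs, mul_div_cancel₀ _ hs0.ne', neg_neg]
  rw [k] at h1
  rw [k'] at h3
  have h := eq_sum_inner_smul (ho t) (vel (fun s => frenetVec γ s 2) t)
  have e0 : inner ℝ (frenetVec γ t 0) (vel (fun s => frenetVec γ s 2) t) = 0 := by
    rw [hγ.frenetVec_zero3]
    simpa using h0
  have e1 : inner ℝ (frenetVec γ t 1) (vel (fun s => frenetVec γ s 2) t) = -(s * geodCurv γ t) := by
    linarith
  have e2 : inner ℝ (frenetVec γ t 2) (vel (fun s => frenetVec γ s 2) t) = 0 := by linarith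
  have e3 : inner ℝ (frenetVec γ t 3) (vel (fun s => frenetVec γ s 2) t) = s * geodTors γ t := by
    linarith
  rw [Fin.sum_univ_four, e0, e1, e2, e3] at h
  rw [h]
  module

end Three

end FrenetEquations

/-! ### Recognizing Frenet frames -/

section MovingFrames

theorem hasVel_of_vel_eq {E : Type*} [NormedAddCommGroup E] [InnerProductSpace ℝ E]
    {f : I → E} {t : I} {a : E} (h : HasVel f (vel f t) t) (e : vel f t = a) : HasVel f a t :=
  e ▸ h

/-- A curve on `𝕊²` that moves along the second vector of a moving frame of rotations, starting
with the curve itself, is generic and has this frame as its Frenet frame. -/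
theorem frenet_of_movingFrame2 {γ : SmoothCurve (Euc (2 + 1))} {z : I → Spin3} {s : I → ℝ}
    (h0 : ∀ t, γ t = frame3 (z t) 0) (hs : ∀ t, 0 < s t)
    (h1 : ∀ t, vel γ t = s t • frame3 (z t) 1) :
    IsGeneric γ ∧ (∀ t, frenetVec γ t = frame3 (z t)) ∧ ∀ t, ‖vel γ t‖ = s t := by
  have key (t : I) (j : Fin 2) : derivN j γ t = (![1, s t] : Fin 2 → ℝ) j •
      frame3 (z t) j.castSucc +
      ∑ i ∈ Finset.Iio j, (fun _ _ => 0 : Fin 2 → Fin 2 → ℝ) j i • frame3 (z t) i.castSucc := by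
    fin_cases j
    · simp [derivN_zero, h0]
    · simp [derivN_one, h1]
  have hpos (t : I) (j : Fin 2) : 0 < (![1, s t] : Fin 2 → ℝ) j := by
    fin_cases j
    · simp
    · simpa using hs t
  have ho (t : I) := orthonormal_frame3 (z t)
  refine ⟨⟨fun t => ?_, fun t => ?_⟩, fun t => ?_, fun t => ?_⟩
  · rw [h0, (ho t).1]
  · exact linearIndependent_of_triangular (f := fun j : Fin 2 => derivN j γ t)
      (e := fun j : Fin 2 => frame3 (z t) j.castSucc)
      ((ho t).comp _ (Fin.castSucc_injective 2)) (fun j => (hpos t j).ne') (key t)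
  · refine frenetVec_eq_of_triangular (ho t) ?_ (hpos t) (key t)
    rw [← Pi3_eq, det_Pi3]
  · rw [h1, norm_smul, (ho t).1, mul_one, Real.norm_of_nonneg (hs t).le]

/-- The analogue of `frenet_of_movingFrame2` on `𝕊³`: here the acceleration has to be a
combination of the first three vectors of the moving frame. -/
theorem frenet_of_movingFrame3 {γ : SmoothCurve (Euc (3 + 1))} {z : I → Spin4}
    {v a0 a1 c : I → ℝ}
    (h0 : ∀ t, γ t = frame4 (z t) 0) (hv : ∀ t, 0 < v t)
    (h1 : ∀ t, vel γ t = v t • frame4 (z t) 1) (hc : ∀ t, 0 < c t)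
    (h2 : ∀ t, vel (vel γ) t =
      a0 t • frame4 (z t) 0 + a1 t • frame4 (z t) 1 + c t • frame4 (z t) 2) :
    IsGeneric γ ∧ (∀ t, frenetVec γ t = frame4 (z t)) := by
  have key (t : I) (j : Fin 3) : derivN j γ t = (![1, v t, c t] : Fin 3 → ℝ) j •
      frame4 (z t) j.castSucc +
      ∑ i ∈ Finset.Iio j, (![![0, 0, 0], ![0, 0, 0], ![a0 t, a1 t, 0]] : Fin 3 → Fin 3 → ℝ) j i •
        frame4 (z t) i.castSucc := by
    have hIio : Finset.Iio (2 : Fin 3) = {0, 1} := by decide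
    have hIio' : Finset.Iio (1 : Fin 3) = {0} := by decide
    have hIio'' : Finset.Iio (0 : Fin 3) = ∅ := by decide
    fin_cases j
    · simp [derivN_zero, h0, hIio'']
    · simp [derivN_one, h1, hIio']
    · simp [derivN_succ, derivN_zero, h2, hIio]
      abel
  have hpos (t : I) (j : Fin 3) : 0 < (![1, v t, c t] : Fin 3 → ℝ) j := by
    fin_cases j
    · simp
    · simpa using hv t
    · simpa using hc t
  have ho (t : I) := orthonormal_frame4 (z t)
  refine ⟨⟨fun t => ?_, fun t => ?_⟩, fun t => ?_⟩
  · rw [h0, (ho t).1]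
  · exact linearIndependent_of_triangular (f := fun j : Fin 3 => derivN j γ t)
      (e := fun j : Fin 3 => frame4 (z t) j.castSucc)
      ((ho t).comp _ (Fin.castSucc_injective 3)) (fun j => (hpos t j).ne') (key t)
  · refine frenetVec_eq_of_triangular (ho t) ?_ (hpos t) (key t)
    rw [← Pi4_eq, det_Pi4]

end MovingFrames

/-! ### Curves on `𝕊³` and their moving frames -/

section Forward

variable {zl zr : Spin3}

/-- The identification of `ℝ⁴` with the quaternions as a continuous linear map. -/
noncomputable def quatOf : Euc (3 + 1) →L[ℝ] Quaternion ℝ :=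
  quatEquiv.symm.toContinuousLinearEquiv.toContinuousLinearMap

theorem quatOf_frame4 (z : Spin4) (j : Fin 4) :
    quatOf (frame4 z j) = spinIso z.1 z.2 (unitQ j) :=
  quatEquiv.symm_apply_apply _

/-- As `𝐤 = 𝐢 𝐣`, the binormal is a quaternion polynomial in the other Frenet vectors. -/
theorem frame4_three (z : Spin4) : frame4 z 3 =
    quatEquiv (quatOf (frame4 z 1) * star (quatOf (frame4 z 0)) * quatOf (frame4 z 2)) := by
  simp only [quatOf_frame4, spinIso_mul_star, spinIso_mul]
  have e : unitQ 1 * star (unitQ 0) * unitQ 2 = unitQ 3 := by ext <;> simp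
  rw [e]
  rfl

theorem GS3.exists_frame (γ : GS3 zl zr) (t : I) : ∃ z : Spin4, frenetVec γ.1 t = frame4 z := by
  obtain ⟨w, hw, -⟩ := γ.2.2
  exact ⟨w t, Pi4_eq_frenetFrame_iff.1 (hw.2 t)⟩

theorem GS3.orthonormal (γ : GS3 zl zr) (t : I) : Orthonormal ℝ (frenetVec γ.1 t) := by
  obtain ⟨z, hz⟩ := GS3.exists_frame γ t
  rw [hz]
  exact orthonormal_frame4 z

theorem GS3.smoothFamily_position : SmoothFamily fun γ : GS3 zl zr => γ.1.toFun :=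
  smoothFamily_curve.comp continuous_subtype_val

theorem GS3.smoothFamily_speed : SmoothFamily fun (γ : GS3 zl zr) t => ‖vel γ.1 t‖ :=
  SphereCurves.smoothFamily_speed continuous_subtype_val fun γ t => γ.2.1.1.speed_pos3 t

theorem GS3.smoothFamily_unitTangent : SmoothFamily fun γ : GS3 zl zr => unitTangent γ.1 :=
  SphereCurves.smoothFamily_unitTangent continuous_subtype_val fun γ t => γ.2.1.1.speed_pos3 t

theorem GS3.vel_unitTangent (γ : GS3 zl zr) (t : I) :
    0 < geodCurv γ.1 t ∧ vel (unitTangent γ.1) t =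
      ‖vel γ.1 t‖ • (-γ.1 t + geodCurv γ.1 t • frenetVec γ.1 t 2) :=
  vel_unitTangent3 γ.2.1.1 (GS3.orthonormal γ) (GS3.smoothFamily_speed.hasVel γ t)
    (GS3.smoothFamily_unitTangent.hasVel γ t)

/-- The normal is the normalization of `𝐭' + ‖γ'‖ γ`. -/
theorem GS3.smoothFamily_normal : SmoothFamily fun (γ : GS3 zl zr) t => frenetVec γ.1 t 2 := by
  have h (γ : GS3 zl zr) (t : I) : vel (unitTangent γ.1) t + ‖vel γ.1 t‖ • γ.1 t =
      (‖vel γ.1 t‖ * geodCurv γ.1 t) • frenetVec γ.1 t 2 := by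
    rw [(GS3.vel_unitTangent γ t).2]
    module
  have hpos (γ : GS3 zl zr) (t : I) : 0 < ‖vel γ.1 t‖ * geodCurv γ.1 t :=
    mul_pos (γ.2.1.1.speed_pos3 t) (GS3.vel_unitTangent γ t).1
  have hM : SmoothFamily fun (γ : GS3 zl zr) t =>
      vel (unitTangent γ.1) t + ‖vel γ.1 t‖ • γ.1 t :=
    GS3.smoothFamily_unitTangent.vel.add
      (GS3.smoothFamily_speed.smul GS3.smoothFamily_position)
  have hn (γ : GS3 zl zr) (t : I) : ‖vel (unitTangent γ.1) t + ‖vel γ.1 t‖ • γ.1 t‖ =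
      ‖vel γ.1 t‖ * geodCurv γ.1 t := by
    rw [h, norm_smul, (GS3.orthonormal γ t).1, mul_one, Real.norm_of_nonneg (hpos γ t).le]
  have h0 (γ : GS3 zl zr) (t : I) : ‖vel (unitTangent γ.1) t + ‖vel γ.1 t‖ • γ.1 t‖ ≠ 0 := by
    rw [hn]
    exact (hpos γ t).ne'
  have := ((hM.norm fun γ t => norm_ne_zero_iff.1 (h0 γ t)).inv h0).smul hM
  convert this using 3 with γ t
  rw [hn, h, smul_smul, inv_mul_cancel₀ (hpos γ t).ne', one_smul]

theorem GS3.smoothFamily_binormal : SmoothFamily fun (γ : GS3 zl zr) t => frenetVec γ.1 t 3 := by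
  have := (((GS3.smoothFamily_unitTangent (zl := zl) (zr := zr)).clm quatOf).mul
    (GS3.smoothFamily_position.clm quatOf).star).mul (GS3.smoothFamily_normal.clm quatOf)
  convert this.clm quatEquiv.toContinuousLinearEquiv.toContinuousLinearMap using 3 with γ t
  obtain ⟨z, hz⟩ := GS3.exists_frame γ t
  rw [← γ.2.1.1.frenetVec_zero3, ← γ.2.1.1.frenetVec_one3, hz]
  exact frame4_three z

theorem GS3.hasVel_position (γ : GS3 zl zr) (t : I) :
    HasVel γ.1 (‖vel γ.1 t‖ • frenetVec γ.1 t 1) t :=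
  hasVel_of_vel_eq (γ.1.hasVel t) (by rw [γ.2.1.1.frenetVec_one3, norm_smul_unitTangent])

theorem GS3.hasVel_unitTangent (γ : GS3 zl zr) (t : I) :
    HasVel (unitTangent γ.1)
      (‖vel γ.1 t‖ • (-frenetVec γ.1 t 0 + geodCurv γ.1 t • frenetVec γ.1 t 2)) t :=
  hasVel_of_vel_eq (GS3.smoothFamily_unitTangent.hasVel γ t)
    (by rw [γ.2.1.1.frenetVec_zero3, (GS3.vel_unitTangent γ t).2])

theorem GS3.hasVel_normal (γ : GS3 zl zr) (t : I) :
    HasVel (fun s => frenetVec γ.1 s 2) (‖vel γ.1 t‖ •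
      (-(geodCurv γ.1 t • frenetVec γ.1 t 1) + geodTors γ.1 t • frenetVec γ.1 t 3)) t :=
  hasVel_of_vel_eq (GS3.smoothFamily_normal.hasVel γ t)
    (vel_normal3 γ.2.1.1 (GS3.orthonormal γ) (GS3.smoothFamily_unitTangent.hasVel γ t)
      (GS3.smoothFamily_normal.hasVel γ t) (GS3.smoothFamily_binormal.hasVel γ t))

/-! ### The left and the right curve -/

theorem smoothFamily_left : SmoothFamily fun (γ : GS3 zl zr) t =>
    imProj (quatOf (unitTangent γ.1 t) * star (quatOf (γ.1 t))) :=
  ((GS3.smoothFamily_unitTangent.clm quatOf).mul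
    (GS3.smoothFamily_position.clm quatOf).star).clm imProj

theorem smoothFamily_right : SmoothFamily fun (γ : GS3 zl zr) t =>
    imProj (star (quatOf (γ.1 t)) * quatOf (unitTangent γ.1 t)) :=
  ((GS3.smoothFamily_position.clm quatOf).star.mul
    (GS3.smoothFamily_unitTangent.clm quatOf)).clm imProj

/-- The left part `𝐭 γ̄` of a generic curve `γ` on `𝕊³`. -/
noncomputable def leftCurve (γ : GS3 zl zr) : SmoothCurve (Euc (2 + 1)) :=
  smoothFamily_left.toCurve γ

/-- The right part `γ̄ 𝐭` of a generic curve `γ` on `𝕊³`. -/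
noncomputable def rightCurve (γ : GS3 zl zr) : SmoothCurve (Euc (2 + 1)) :=
  smoothFamily_right.toCurve γ

theorem leftCurve_apply (γ : GS3 zl zr) (t : I) : leftCurve γ t =
    imProj (quatOf (unitTangent γ.1 t) * star (quatOf (γ.1 t))) := rfl

theorem rightCurve_apply (γ : GS3 zl zr) (t : I) : rightCurve γ t =
    imProj (star (quatOf (γ.1 t)) * quatOf (unitTangent γ.1 t)) := rfl

theorem continuous_leftCurve : Continuous (leftCurve : GS3 zl zr → _) :=
  smoothFamily_left.continuous_toCurve

theorem continuous_rightCurve : Continuous (rightCurve : GS3 zl zr → _) :=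
  smoothFamily_right.continuous_toCurve

/-- The geodesic curvature of a curve on `𝕊²` with the moving frame `frame3 ∘ z` and the speed `s`
is read off from the derivative of its tangent. -/
theorem geodCurv_of_movingFrame2 {γ : SmoothCurve (Euc (2 + 1))} {z : I → Spin3} {s : I → ℝ}
    (h0 : ∀ t, γ t = frame3 (z t) 0) (hs : ∀ t, 0 < s t)
    (h1 : ∀ t, vel γ t = s t • frame3 (z t) 1) {t : I} {a b : ℝ}
    (h2 : HasVel (fun r => frame3 (z r) 1) (a • frame3 (z t) 0 + b • frame3 (z t) 2) t) :
    geodCurv γ t = b / s t := by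
  obtain ⟨hg, hf, hn⟩ := frenet_of_movingFrame2 h0 hs h1
  have e : unitTangent γ = fun r => frame3 (z r) 1 := by
    ext1 r
    rw [← hg.frenetVec_one2, hf]
  rw [geodCurv, hn, e, h2.vel_eq, hf]
  have o := orthonormal_iff_ite.1 (orthonormal_frame3 (z t))
  congr 1
  rw [inner_add_left, inner_smul_left, inner_smul_left, o, o]
  simp

section Lift

variable {γ : GS3 zl zr} {a b : I → Spin3} (hab : ∀ t, frenetVec γ.1 t = frame4 (a t, b t))
include hab

theorem quatOf_frenetVec (t : I) (j : Fin (3 + 1)) :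
    quatOf (frenetVec γ.1 t j) = spinIso (a t) (b t) (unitQ j) := by
  rw [hab, quatOf_frame4]

theorem leftCurve_eq (t : I) : leftCurve γ t = frame3 (a t) 0 := by
  rw [leftCurve_apply, ← γ.2.1.1.frenetVec_zero3, ← γ.2.1.1.frenetVec_one3,
    quatOf_frenetVec hab, quatOf_frenetVec hab, spinIso_mul_star, frame3]
  congr 2
  ext <;> simp

theorem rightCurve_eq (t : I) : rightCurve γ t = frame3 (b t) 0 := by
  rw [rightCurve_apply, ← γ.2.1.1.frenetVec_zero3, ← γ.2.1.1.frenetVec_one3,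
    quatOf_frenetVec hab, quatOf_frenetVec hab, star_spinIso_mul, frame3]
  congr 2
  ext <;> simp

theorem hasVel_leftCurve (t : I) :
    HasVel (leftCurve γ) ((‖vel γ.1 t‖ * geodCurv γ.1 t) • frame3 (a t) 1) t := by
  have h := (((GS3.hasVel_unitTangent γ t).clm quatOf).mul
    ((GS3.hasVel_position γ t).clm quatOf).star).clm imProj
  refine h.congr ?_
  rw [← γ.2.1.1.frenetVec_zero3, ← γ.2.1.1.frenetVec_one3]
  simp only [map_smul, map_add, map_neg, quatOf_frenetVec hab, Quaternion.star_smul,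
    add_mul, neg_mul, smul_mul_assoc, mul_smul_comm, spinIso_mul_star, frame3]
  have e1 : unitQ 0 * star (unitQ 0) = unitQ 1 * star (unitQ 1) := by ext <;> simp
  have e2 : unitQ 2 * star (unitQ 0) = unitQ (Fin.succ 1) := by ext <;> simp
  rw [e1, e2]
  module

theorem hasVel_rightCurve (t : I) :
    HasVel (rightCurve γ) ((‖vel γ.1 t‖ * geodCurv γ.1 t) • frame3 (b t) 1) t := by
  have h := (((GS3.hasVel_position γ t).clm quatOf).star.mul
    ((GS3.hasVel_unitTangent γ t).clm quatOf)).clm imProj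
  refine h.congr ?_
  rw [← γ.2.1.1.frenetVec_zero3, ← γ.2.1.1.frenetVec_one3]
  simp only [map_smul, map_add, map_neg, quatOf_frenetVec hab, Quaternion.star_smul,
    mul_add, mul_neg, smul_mul_assoc, mul_smul_comm, star_spinIso_mul, frame3]
  have e1 : star (unitQ 0) * unitQ 0 = star (unitQ 1) * unitQ 1 := by ext <;> simp
  have e2 : star (unitQ 0) * unitQ 2 = unitQ (Fin.succ 1) := by ext <;> simp
  rw [e1, e2]
  module

/-- The derivative of `a 𝐣 ā = 𝐧 γ̄`. Here `𝐧 𝐭̄ = a 𝐤 ā` adds `1` to the torsion. -/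
theorem hasVel_leftTangent (t : I) : HasVel (fun s => frame3 (a s) 1)
    ((-(‖vel γ.1 t‖ * geodCurv γ.1 t)) • frame3 (a t) 0 +
      (‖vel γ.1 t‖ * (geodTors γ.1 t + 1)) • frame3 (a t) 2) t := by
  have h := (((GS3.hasVel_normal γ t).clm quatOf).mul
    ((GS3.hasVel_position γ t).clm quatOf).star).clm imProj
  have e2 : unitQ 2 * star (unitQ 0) = unitQ (Fin.succ 1) := by ext <;> simp
  have e : (fun s => frame3 (a s) 1) = fun s =>
      imProj (quatOf (frenetVec γ.1 s 2) * star (quatOf (γ.1 s))) := by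
    ext1 s
    rw [← γ.2.1.1.frenetVec_zero3, quatOf_frenetVec hab, quatOf_frenetVec hab,
      spinIso_mul_star, e2]
    rfl
  rw [e]
  refine h.congr ?_
  rw [← γ.2.1.1.frenetVec_zero3]
  simp only [map_smul, map_add, map_neg, quatOf_frenetVec hab, Quaternion.star_smul,
    add_mul, neg_mul, smul_mul_assoc, mul_smul_comm, spinIso_mul_star, frame3]
  have e1 : unitQ 1 * star (unitQ 0) = unitQ (Fin.succ 0) := by ext <;> simp
  have e3 : unitQ 3 * star (unitQ 0) = unitQ (Fin.succ 2) := by ext <;> simp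
  have e4 : unitQ 2 * star (unitQ 1) = unitQ (Fin.succ 2) := by ext <;> simp
  rw [e1, e3, e4]
  module

/-- The derivative of `b 𝐣 b̄ = γ̄ 𝐧`. Here `𝐭̄ 𝐧 = -b 𝐤 b̄` subtracts `1` from the torsion. -/
theorem hasVel_rightTangent (t : I) : HasVel (fun s => frame3 (b s) 1)
    ((-(‖vel γ.1 t‖ * geodCurv γ.1 t)) • frame3 (b t) 0 +
      (‖vel γ.1 t‖ * (geodTors γ.1 t - 1)) • frame3 (b t) 2) t := by
  have h := (((GS3.hasVel_position γ t).clm quatOf).star.mul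
    ((GS3.hasVel_normal γ t).clm quatOf)).clm imProj
  have e2 : star (unitQ 0) * unitQ 2 = unitQ (Fin.succ 1) := by ext <;> simp
  have e : (fun s => frame3 (b s) 1) = fun s =>
      imProj (star (quatOf (γ.1 s)) * quatOf (frenetVec γ.1 s 2)) := by
    ext1 s
    rw [← γ.2.1.1.frenetVec_zero3, quatOf_frenetVec hab, quatOf_frenetVec hab,
      star_spinIso_mul, e2]
    rfl
  rw [e]
  refine h.congr ?_
  rw [← γ.2.1.1.frenetVec_zero3]
  simp only [map_smul, map_add, map_neg, quatOf_frenetVec hab, Quaternion.star_smul,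
    mul_add, mul_neg, smul_mul_assoc, mul_smul_comm, star_spinIso_mul, frame3]
  have e1 : star (unitQ 0) * unitQ 1 = unitQ (Fin.succ 0) := by ext <;> simp
  have e3 : star (unitQ 0) * unitQ 3 = unitQ (Fin.succ 2) := by ext <;> simp
  have e4 : star (unitQ 1) * unitQ 2 = -unitQ (Fin.succ 2) := by ext <;> simp
  rw [e1, e3, e4, map_neg, map_neg]
  module

theorem leftCurve_frenet : IsGeneric (leftCurve γ) ∧
    (∀ t, frenetVec (leftCurve γ) t = frame3 (a t)) ∧
    (∀ t, ‖vel (leftCurve γ) t‖ = ‖vel γ.1 t‖ * geodCurv γ.1 t) ∧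
    ∀ t, geodCurv (leftCurve γ) t = (geodTors γ.1 t + 1) / geodCurv γ.1 t := by
  have hpos (t : I) : 0 < ‖vel γ.1 t‖ * geodCurv γ.1 t :=
    mul_pos (γ.2.1.1.speed_pos3 t) (GS3.vel_unitTangent γ t).1
  have hv (t : I) := (hasVel_leftCurve hab t).vel_eq
  obtain ⟨h1, h2, h3⟩ := frenet_of_movingFrame2 (leftCurve_eq hab) hpos hv
  refine ⟨h1, h2, h3, fun t => ?_⟩
  rw [geodCurv_of_movingFrame2 (leftCurve_eq hab) hpos hv (hasVel_leftTangent hab t),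
    mul_div_mul_left _ _ (γ.2.1.1.speed_pos3 t).ne']

theorem rightCurve_frenet : IsGeneric (rightCurve γ) ∧
    (∀ t, frenetVec (rightCurve γ) t = frame3 (b t)) ∧
    (∀ t, ‖vel (rightCurve γ) t‖ = ‖vel γ.1 t‖ * geodCurv γ.1 t) ∧
    ∀ t, geodCurv (rightCurve γ) t = (geodTors γ.1 t - 1) / geodCurv γ.1 t := by
  have hpos (t : I) : 0 < ‖vel γ.1 t‖ * geodCurv γ.1 t :=
    mul_pos (γ.2.1.1.speed_pos3 t) (GS3.vel_unitTangent γ t).1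
  have hv (t : I) := (hasVel_rightCurve hab t).vel_eq
  obtain ⟨h1, h2, h3⟩ := frenet_of_movingFrame2 (rightCurve_eq hab) hpos hv
  refine ⟨h1, h2, h3, fun t => ?_⟩
  rw [geodCurv_of_movingFrame2 (rightCurve_eq hab) hpos hv (hasVel_rightTangent hab t),
    mul_div_mul_left _ _ (γ.2.1.1.speed_pos3 t).ne']

end Lift

end Forward

/-! ### Differentiability of lifted frames -/

section LiftDerivative

theorem HasVel.congr_of_eventuallyEq {E : Type*} [NormedAddCommGroup E] [NormedSpace ℝ E]
    {f g : I → E} {f' : E} {t : I} (h : HasVel f f' t) (e : ∀ᶠ s in 𝓝 t, g s = f s) :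
    HasVel g f' t := by
  have hp : Filter.Tendsto (Set.projIcc (0 : ℝ) 1 zero_le_one) (𝓝 (t : ℝ)) (𝓝 t) := by
    have := (continuous_projIcc (h := zero_le_one (α := ℝ))).tendsto (t : ℝ)
    rwa [Set.projIcc_val] at this
  refine HasDerivWithinAt.congr_of_eventuallyEq h
    (Filter.Eventually.filter_mono nhdsWithin_le_nhds (hp.eventually e)) ?_
  rw [extend_coe, extend_coe]
  exact e.self_of_nhds

/-- The lift `a` of the Frenet frame of a curve on `𝕊²` of speed `s` and curvature `κ` solves
`a' = a (s / 2) (κ 𝐢 + 𝐤)`. Differentiability holds since near `t` the lift is the normalization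
of an affine function of the frame. -/
theorem hasVel_lift {a : C(I, Spin3)} {s κ : ℝ} {t : I}
    (h0 : HasVel (fun r => frame3 (a r) 0) (s • frame3 (a t) 1) t)
    (h1 : HasVel (fun r => frame3 (a r) 1) (s • (-frame3 (a t) 0 + κ • frame3 (a t) 2)) t)
    (h2 : HasVel (fun r => frame3 (a r) 2) (-(s * κ) • frame3 (a t) 1) t) :
    HasVel (fun r => (a r : Quaternion ℝ))
      (a t * ((s / 2) • (κ • unitQ 1 + unitQ 3))) t := by
  set c : Quaternion ℝ := ((a t : Spin3) : Quaternion ℝ) with hc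
  -- `P r = 4 ⟪a r, c⟫ a r` is affine in the frame, hence differentiable
  set P : I → Quaternion ℝ := fun r => c + (imEmb (frame3 (a r) 0) * (c * star (unitQ 1)) +
    (imEmb (frame3 (a r) 1) * (c * star (unitQ 2)) +
      imEmb (frame3 (a r) 2) * (c * star (unitQ 3)))) with hP
  have hPa (r : I) : P r = (4 * inner ℝ (a r : Quaternion ℝ) c) • (a r : Quaternion ℝ) := by
    rw [← sum_conj_unitQ, self_mul_star_spin, Fin.sum_univ_three, one_mul, add_assoc]
    simp only [hP, imEmb_frame3, spinIso_apply, mul_assoc]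
    rfl
  have hPt : P t = (4 : ℝ) • c := by
    rw [hPa, ← hc, real_inner_self_eq_norm_sq, norm_spin]
    norm_num
  have hcc : inner ℝ c c = (1 : ℝ) := by rw [real_inner_self_eq_norm_sq, norm_spin, one_pow]
  have hP' : HasVel P ((4 : ℝ) • (c * ((s / 2) • (κ • unitQ 1 + unitQ 3)))) t := by
    have k (j : Fin 3) {f' : Euc 3} (h : HasVel (fun r => frame3 (a r) j) f' t) :
        HasVel (fun r => imEmb (frame3 (a r) j) * (c * star (unitQ j.succ)))
          (imEmb f' * (c * star (unitQ j.succ))) t := by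
      have := (h.clm imEmb.toContinuousLinearMap).mul (HasVel.const (c * star (unitQ j.succ)) t)
      rw [mul_zero, add_zero] at this
      exact this
    refine ((HasVel.const c t).add ((k 0 h0).add ((k 1 h1).add (k 2 h2)))).congr ?_
    have e (j : Fin 3) (q : Quaternion ℝ) :
        spinIso (a t) (a t) (unitQ j.succ) * (c * q) = c * (unitQ j.succ * q) := by
      rw [spinIso_apply, ← hc]
      calc c * unitQ j.succ * star c * (c * q) = c * unitQ j.succ * (star c * c) * q := by
            noncomm_ring
        _ = _ := by rw [star_mul_self_spin]; noncomm_ring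
    simp only [map_smul, map_add, map_neg, imEmb_frame3, smul_mul_assoc, add_mul, neg_mul, e]
    simp only [← mul_smul_comm, ← mul_add, ← mul_neg, zero_add]
    congr 1
    ext <;> simp <;> ring
  -- `c` times an imaginary quaternion is orthogonal to `c`, so the scalar factor is stationary
  have hd : inner ℝ ((4 : ℝ) • (c * ((s / 2) • (κ • unitQ 1 + unitQ 3)))) c = (0 : ℝ) := by
    rw [Quaternion.inner_def]
    simp
    ring
  have hρ := (HasVel.inner hP' (HasVel.const c t))
  rw [hd, inner_zero_right, add_zero] at hρ
  have hρt : inner ℝ (P t) c = (4 : ℝ) := by rw [hPt, inner_smul_left, hcc]; simp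
  have hs4 : √(4 : ℝ) = 2 := by
    rw [show (4 : ℝ) = 2 ^ 2 by norm_num]
    exact Real.sqrt_sq (by norm_num)
  have hsq := hρ.sqrt (by rw [hρt]; norm_num)
  have h2s := (HasVel.const (2 : ℝ) t).mul hsq
  have hinv := (h2s.inv (by rw [hρt, hs4]; norm_num)).smul hP'
  have hfin := hinv.congr (a := c * ((s / 2) • (κ • unitQ 1 + unitQ 3))) (by
    rw [hρt, hs4]
    simp only [mul_zero, zero_mul, add_zero, neg_zero, zero_smul, zero_add, smul_smul]
    norm_num)
  refine hfin.congr_of_eventuallyEq ?_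
  have hcont : Continuous fun r => (inner ℝ (a r : Quaternion ℝ) c : ℝ) :=
    (continuous_subtype_val.comp a.continuous).inner continuous_const
  have hpos : ∀ᶠ r in 𝓝 t, 0 < (inner ℝ (a r : Quaternion ℝ) c : ℝ) :=
    hcont.continuousAt.eventually (lt_mem_nhds (by
      change (0 : ℝ) < inner ℝ c c
      rw [hcc]
      exact one_pos))
  -- where `⟪a, c⟫ > 0`, it equals `√⟪P, c⟫ / 2`
  filter_upwards [hpos] with r hr
  set ρ : ℝ := inner ℝ (a r : Quaternion ℝ) c
  have e : inner ℝ (P r) c = (2 * ρ) ^ 2 := by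
    rw [hPa, inner_smul_left]
    simp
    ring
  rw [e, Real.sqrt_sq (by positivity), hPa, smul_smul]
  change _ = ((2 * (2 * ρ))⁻¹ * (4 * ρ)) • (a r : Quaternion ℝ)
  rw [show (2 * (2 * ρ))⁻¹ * (4 * ρ) = 1 by field_simp; norm_num, one_smul]

end LiftDerivative

/-! ### Linear equations with imaginary coefficients -/

section SkewODE

variable {X : Type*} [TopologicalSpace X]

theorem continuous_of_hasVel {E : Type*} [NormedAddCommGroup E] [NormedSpace ℝ E] {f f' : I → E}
    (h : ∀ t, HasVel f (f' t) t) : Continuous f := by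
  have hc : ContinuousOn (Set.IccExtend zero_le_one f) (Icc (0 : ℝ) 1) :=
    fun s hs => (h ⟨s, hs⟩).continuousWithinAt
  have : f = (Icc (0 : ℝ) 1).domRestrict (Set.IccExtend zero_le_one f) := by
    ext t
    exact (extend_coe f t).symm
  rw [this]
  exact hc.domRestrict

/-- Solutions of `u' = β u` with imaginary `β` stay as close to each other as the coefficients:
`ū₁ u₂` has the derivative `ū₁ (β₂ - β₁) u₂`. -/
theorem norm_sub_le_of_skew_ode {β₁ β₂ u₁ u₂ : I → Quaternion ℝ} {C : ℝ}
    (hβ : ∀ t, star (β₁ t) = -β₁ t) (hu₁ : ∀ t, HasVel u₁ (β₁ t * u₁ t) t)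
    (hu₂ : ∀ t, HasVel u₂ (β₂ t * u₂ t) t) (hn₁ : ∀ t, ‖u₁ t‖ = 1) (hn₂ : ∀ t, ‖u₂ t‖ = 1)
    (h0 : u₁ 0 = u₂ 0) (hC : ∀ t, ‖β₂ t - β₁ t‖ ≤ C) (t : I) : ‖u₂ t - u₁ t‖ ≤ C := by
  have hC0 : 0 ≤ C := (norm_nonneg _).trans (hC 0)
  have hone (t : I) : star (u₁ t) * u₁ t = 1 := by
    rw [Quaternion.star_mul_self, Quaternion.normSq_eq_norm_mul_self, hn₁]
    simp
  have hone' (t : I) : u₁ t * star (u₁ t) = 1 := by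
    rw [Quaternion.self_mul_star, Quaternion.normSq_eq_norm_mul_self, hn₁]
    simp
  set V : I → Quaternion ℝ := fun t => star (u₁ t) * u₂ t with hV
  have hV' (t : I) : HasVel V (star (u₁ t) * (β₂ t - β₁ t) * u₂ t) t := by
    refine ((hu₁ t).star.mul (hu₂ t)).congr ?_
    rw [star_mul, hβ]
    noncomm_ring
  have hmv := (convex_Icc (0 : ℝ) 1).norm_image_sub_le_of_norm_hasDerivWithin_le
    (f := Set.IccExtend zero_le_one V)
    (f' := Set.IccExtend zero_le_one fun t => star (u₁ t) * (β₂ t - β₁ t) * u₂ t) (C := C)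
    (fun s hs => by
      have := hV' ⟨s, hs⟩
      rwa [Set.IccExtend_of_mem _ _ hs])
    (fun s hs => by
      rw [Set.IccExtend_of_mem _ _ hs, norm_mul, norm_mul, Quaternion.norm_star, hn₁, hn₂]
      simpa using hC ⟨s, hs⟩)
    (x := ((0 : I) : ℝ)) (y := (t : ℝ)) (0 : I).2 t.2
  rw [extend_coe, extend_coe] at hmv
  have hV0 : V 0 = 1 := by
    rw [← hone 0]
    simp only [hV, h0]
  have e : u₂ t - u₁ t = u₁ t * (V t - V 0) := by
    rw [hV0, mul_sub, mul_one]
    simp only [hV]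
    rw [← mul_assoc, hone', one_mul]
  rw [e, norm_mul, hn₁, one_mul]
  refine hmv.trans (mul_le_of_le_one_right hC0 ?_)
  rw [Real.norm_eq_abs, Set.Icc.coe_zero, sub_zero, abs_of_nonneg t.2.1]
  exact t.2.2

/-- Unit solutions of `u' = β u` depend smoothly on the parameter if the imaginary coefficient
`β` does. Higher derivatives follow from the equation itself. -/
theorem smoothFamily_of_skew_ode {β u : X → I → Quaternion ℝ} (hβ : SmoothFamily β)
    (hskew : ∀ x t, star (β x t) = -β x t) (hu : ∀ x t, HasVel (u x) (β x t * u x t) t)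
    (hn : ∀ x t, ‖u x t‖ = 1) (h0 : ∀ x y, u x 0 = u y 0) : SmoothFamily u := by
  let B : X → C(I, Quaternion ℝ) := fun x =>
    ⟨β x, hβ.continuous.comp (Continuous.prodMk_right x)⟩
  have hB : Continuous B :=
    ContinuousMap.continuous_of_continuous_uncurry _ hβ.continuous
  let U : X → C(I, Quaternion ℝ) := fun x => ⟨u x, continuous_of_hasVel (hu x)⟩
  have hUB (x y : X) : dist (U x) (U y) ≤ dist (B x) (B y) := by
    rw [ContinuousMap.dist_le dist_nonneg]
    intro t
    rw [dist_eq_norm]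
    refine norm_sub_le_of_skew_ode (hskew y) (hu y) (hu x) (hn y) (hn x) (h0 y x) (fun s => ?_) t
    rw [← dist_eq_norm]
    exact ContinuousMap.dist_apply_le_dist (f := B x) (g := B y) s
  have hU : Continuous U := by
    refine continuous_iff_continuousAt.2 fun x => tendsto_iff_dist_tendsto_zero.2 ?_
    exact squeeze_zero (fun _ => dist_nonneg) (fun y => hUB y x)
      (tendsto_iff_dist_tendsto_zero.1 hB.continuousAt)
  have hu0 : Continuous fun p : X × I => u p.1 p.2 :=
    continuous_eval.comp (hU.prodMap continuous_id)
  intro k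
  induction k with
  | zero => exact hu0
  | succ k ih => exact JetCont.succ_of_hasVel hu0 hu ((hβ k).mul ih)

end SkewODE

/-! ### Curves on `𝕊²` and their lifts -/

section GS2

variable {z : Spin3}

/-- The lifted Frenet frame of a curve on `𝕊²`. -/
noncomputable def GS2.lift (γ : GS2 z) : C(I, Spin3) := γ.2.2.choose

theorem GS2.isLiftedFrame_lift (γ : GS2 z) : IsLiftedFrame Pi3 γ.1 (GS2.lift γ) :=
  γ.2.2.choose_spec.1

theorem GS2.lift_one (γ : GS2 z) : GS2.lift γ 1 = z := γ.2.2.choose_spec.2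

theorem GS2.frenetVec_eq (γ : GS2 z) (t : I) : frenetVec γ.1 t = frame3 (GS2.lift γ t) :=
  Pi3_eq_frenetFrame_iff.1 ((GS2.isLiftedFrame_lift γ).2 t)

theorem GS2.orthonormal (γ : GS2 z) (t : I) : Orthonormal ℝ (frenetVec γ.1 t) := by
  rw [GS2.frenetVec_eq]
  exact orthonormal_frame3 _

theorem GS2.smoothFamily_position : SmoothFamily fun γ : GS2 z => γ.1.toFun :=
  smoothFamily_curve.comp continuous_subtype_val

theorem GS2.smoothFamily_speed : SmoothFamily fun (γ : GS2 z) t => ‖vel γ.1 t‖ :=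
  SphereCurves.smoothFamily_speed continuous_subtype_val fun γ t => γ.2.1.1.speed_pos2 t

theorem GS2.smoothFamily_unitTangent : SmoothFamily fun γ : GS2 z => unitTangent γ.1 :=
  SphereCurves.smoothFamily_unitTangent continuous_subtype_val fun γ t => γ.2.1.1.speed_pos2 t

theorem GS2.normal_eq (γ : GS2 z) (t : I) :
    frenetVec γ.1 t 2 = imProj (imEmb (γ.1 t) * imEmb (unitTangent γ.1 t)) := by
  rw [← γ.2.1.1.frenetVec_zero2, ← γ.2.1.1.frenetVec_one2, GS2.frenetVec_eq, imEmb_frame3,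
    imEmb_frame3, spinIso_mul, frame3]
  congr 2
  ext <;> simp

theorem GS2.smoothFamily_normal : SmoothFamily fun (γ : GS2 z) t => frenetVec γ.1 t 2 := by
  simp only [GS2.normal_eq]
  exact ((GS2.smoothFamily_position.clm imEmb.toContinuousLinearMap).mul
    (GS2.smoothFamily_unitTangent.clm imEmb.toContinuousLinearMap)).clm imProj

theorem GS2.smoothFamily_geodCurv : SmoothFamily fun (γ : GS2 z) t => geodCurv γ.1 t := by
  simp only [geodCurv, div_eq_mul_inv]
  exact (GS2.smoothFamily_unitTangent.vel.inner GS2.smoothFamily_normal).mul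
    (GS2.smoothFamily_speed.inv fun γ t => (γ.2.1.1.speed_pos2 t).ne')

theorem GS2.hasVel_position (γ : GS2 z) (t : I) :
    HasVel γ.1 (‖vel γ.1 t‖ • frenetVec γ.1 t 1) t :=
  hasVel_of_vel_eq (γ.1.hasVel t) (by rw [γ.2.1.1.frenetVec_one2, norm_smul_unitTangent])

theorem GS2.hasVel_unitTangent (γ : GS2 z) (t : I) :
    HasVel (unitTangent γ.1)
      (‖vel γ.1 t‖ • (-frenetVec γ.1 t 0 + geodCurv γ.1 t • frenetVec γ.1 t 2)) t :=
  hasVel_of_vel_eq (GS2.smoothFamily_unitTangent.hasVel γ t)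
    (by rw [γ.2.1.1.frenetVec_zero2, vel_unitTangent2 γ.2.1.1 (GS2.orthonormal γ)
      (GS2.smoothFamily_unitTangent.hasVel γ t)])

theorem GS2.hasVel_normal (γ : GS2 z) (t : I) :
    HasVel (fun r => frenetVec γ.1 r 2)
      (-(‖vel γ.1 t‖ * geodCurv γ.1 t) • frenetVec γ.1 t 1) t := by
  have h := (((GS2.hasVel_position γ t).clm imEmb.toContinuousLinearMap).mul
    ((GS2.hasVel_unitTangent γ t).clm imEmb.toContinuousLinearMap)).clm imProj
  simp only [GS2.normal_eq γ _]
  refine h.congr ?_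
  rw [← γ.2.1.1.frenetVec_zero2, ← γ.2.1.1.frenetVec_one2]
  simp only [LinearIsometry.coe_toContinuousLinearMap, GS2.frenetVec_eq, map_smul, map_add,
    map_neg, imEmb_frame3, smul_mul_assoc, mul_smul_comm, mul_add, mul_neg, spinIso_mul]
  have e1 : unitQ (Fin.succ 0) * unitQ (Fin.succ 0) =
    unitQ (Fin.succ 1) * unitQ (Fin.succ 1) := by ext <;> simp
  have e2 : unitQ (Fin.succ 0) * unitQ (Fin.succ 2) = -unitQ (Fin.succ 1) := by ext <;> simp
  rw [e1, e2, map_neg, map_neg, frame3]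
  module

theorem GS2.hasVel_lift (γ : GS2 z) (t : I) :
    HasVel (fun r => (GS2.lift γ r : Quaternion ℝ)) (GS2.lift γ t *
      ((‖vel γ.1 t‖ / 2) • (geodCurv γ.1 t • unitQ 1 + unitQ 3))) t := by
  have e0 : (fun r => frame3 (GS2.lift γ r) 0) = γ.1 := by
    ext1 r
    rw [← GS2.frenetVec_eq, γ.2.1.1.frenetVec_zero2]
  have e1 : (fun r => frame3 (GS2.lift γ r) 1) = unitTangent γ.1 := by
    ext1 r
    rw [← GS2.frenetVec_eq, γ.2.1.1.frenetVec_one2]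
  have e2 : (fun r => frame3 (GS2.lift γ r) 2) = fun r => frenetVec γ.1 r 2 := by
    ext1 r
    rw [← GS2.frenetVec_eq]
  refine SphereCurves.hasVel_lift ?_ ?_ ?_
  · rw [e0, ← GS2.frenetVec_eq]
    exact GS2.hasVel_position γ t
  · rw [e1, ← GS2.frenetVec_eq]
    exact GS2.hasVel_unitTangent γ t
  · rw [e2, ← GS2.frenetVec_eq]
    exact GS2.hasVel_normal γ t

end GS2

/-! ### The curve on `𝕊³` built from a pair of curves on `𝕊²` -/

section Backward

variable {zl zr : Spin3}

/-- The speed `‖γₗ'‖ (κₗ - κᵣ) / 2` of the curve on `𝕊³` built from a pair of curves. -/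
noncomputable def pairSpeed (p : PairSpace zl zr) (t : I) : ℝ :=
  ‖vel p.1.1.1 t‖ * (geodCurv p.1.1.1 t - geodCurv p.1.2.1 t) / 2

theorem pairSpeed_pos (p : PairSpace zl zr) (t : I) : 0 < pairSpeed p t :=
  half_pos (mul_pos (p.1.1.2.1.1.speed_pos2 t) (sub_pos.2 (p.2 t).2))

theorem continuous_pair_left : Continuous fun p : PairSpace zl zr => p.1.1 :=
  continuous_fst.comp continuous_subtype_val

theorem continuous_pair_right : Continuous fun p : PairSpace zl zr => p.1.2 :=
  continuous_snd.comp continuous_subtype_val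

theorem smoothFamily_pairSpeed : SmoothFamily (pairSpeed : PairSpace zl zr → I → ℝ) := by
  have hs := GS2.smoothFamily_speed.comp (continuous_pair_left (zl := zl) (zr := zr))
  have hl := GS2.smoothFamily_geodCurv.comp (continuous_pair_left (zl := zl) (zr := zr))
  have hr := GS2.smoothFamily_geodCurv.comp (continuous_pair_right (zl := zl) (zr := zr))
  have e : (pairSpeed : PairSpace zl zr → I → ℝ) = fun p t => ‖vel p.1.1.1 t‖ *
      (geodCurv p.1.1.1 t + (-ContinuousLinearMap.id ℝ ℝ) (geodCurv p.1.2.1 t)) * 2⁻¹ := by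
    ext p t
    simp [pairSpeed]
    ring
  rw [e]
  exact (hs.mul (hl.add (hr.clm (-ContinuousLinearMap.id ℝ ℝ)))).mul
    (SmoothFamily.const (2⁻¹ : ℝ))

/-- The moving frame on `𝕊³` of a pair of curves on `𝕊²`. -/
noncomputable def pairFrame (p : PairSpace zl zr) (t : I) : Spin4 :=
  (GS2.lift p.1.1 t, GS2.lift p.1.2 t)

theorem hasVel_pairFrame (p : PairSpace zl zr) (q : Quaternion ℝ) (t : I) :
    HasVel (fun r => spinIso (pairFrame p r).1 (pairFrame p r).2 q)
      (spinIso (pairFrame p t).1 (pairFrame p t).2 ((‖vel p.1.1.1 t‖ / 2) •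
        ((geodCurv p.1.1.1 t • unitQ 1 + unitQ 3) * q -
          q * (geodCurv p.1.2.1 t • unitQ 1 + unitQ 3)))) t := by
  have h := ((GS2.hasVel_lift p.1.1 t).mul (HasVel.const q t)).mul (GS2.hasVel_lift p.1.2 t).star
  refine h.congr ?_
  have e : star (geodCurv p.1.2.1 t • unitQ 1 + unitQ 3) =
      -(geodCurv p.1.2.1 t • unitQ 1 + unitQ 3) := by ext <;> simp
  rw [← (p.2 t).1, spinIso_apply, star_mul, Quaternion.star_smul, e]
  simp only [pairFrame, mul_zero, add_zero, mul_smul_comm, smul_mul_assoc, mul_sub, sub_mul,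
    smul_sub, smul_neg, neg_mul, mul_neg, mul_assoc]
  rw [sub_eq_add_neg]

theorem hasVel_pairFrame_zero (p : PairSpace zl zr) (t : I) :
    HasVel (fun r => spinIso (pairFrame p r).1 (pairFrame p r).2 (unitQ 0))
      (pairSpeed p t • spinIso (pairFrame p t).1 (pairFrame p t).2 (unitQ 1)) t := by
  refine (hasVel_pairFrame p (unitQ 0) t).congr ?_
  rw [← map_smul]
  congr 1
  ext <;> simp [pairSpeed]
  ring

theorem hasVel_pairFrame_one (p : PairSpace zl zr) (t : I) :
    HasVel (fun r => spinIso (pairFrame p r).1 (pairFrame p r).2 (unitQ 1))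
      (-(pairSpeed p t) • spinIso (pairFrame p t).1 (pairFrame p t).2 (unitQ 0) +
        ‖vel p.1.1.1 t‖ • spinIso (pairFrame p t).1 (pairFrame p t).2 (unitQ 2)) t := by
  refine (hasVel_pairFrame p (unitQ 1) t).congr ?_
  rw [← map_smul, ← map_smul, ← map_add]
  congr 1
  ext <;> simp [pairSpeed] <;> ring

/-- The curve `wₗ w̄ᵣ` solves the linear equation `γ' = (v γₗ) γ` with smooth coefficients. -/
theorem smoothFamily_pairFrame_zero : SmoothFamily fun (p : PairSpace zl zr) t =>
    spinIso (pairFrame p t).1 (pairFrame p t).2 (unitQ 0) := by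
  have hl := GS2.smoothFamily_position.comp (continuous_pair_left (zl := zl) (zr := zr))
  refine smoothFamily_of_skew_ode
    (smoothFamily_pairSpeed.smul (hl.clm imEmb.toContinuousLinearMap)) (fun p t => ?_)
    (fun p t => ?_) (fun p t => ?_) (fun p q => ?_)
  · change star (pairSpeed p t • imEmb (p.1.1.1 t)) = -(pairSpeed p t • imEmb (p.1.1.1 t))
    rw [Quaternion.star_smul, ← smul_neg]
    congr 1
    exact star_imEmb _
  · refine (hasVel_pairFrame_zero p t).congr ?_
    rw [smul_mul_assoc]
    congr 1
    change _ = imEmb (p.1.1.1 t) * _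
    rw [← p.1.1.2.1.1.frenetVec_zero2, GS2.frenetVec_eq, imEmb_frame3]
    have e : unitQ (Fin.succ 0) * unitQ 0 = unitQ 1 := by ext <;> simp
    rw [pairFrame, spinIso_mul, e]
  · rw [LinearIsometry.norm_map]
    exact orthonormal_unitQ.1 0
  · simp only [pairFrame, (GS2.isLiftedFrame_lift _).1]

theorem smoothFamily_pairCurve : SmoothFamily fun (p : PairSpace zl zr) t =>
    frame4 (pairFrame p t) 0 :=
  smoothFamily_pairFrame_zero.clm quatEquiv.toContinuousLinearEquiv.toContinuousLinearMap

/-- The curve `wₗ w̄ᵣ` on `𝕊³` built from the lifted frames of a pair of curves on `𝕊²`. -/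
noncomputable def pairCurve (p : PairSpace zl zr) : SmoothCurve (Euc (3 + 1)) :=
  smoothFamily_pairCurve.toCurve p

theorem continuous_pairCurve : Continuous (pairCurve : PairSpace zl zr → _) :=
  smoothFamily_pairCurve.continuous_toCurve

theorem vel_pairCurve (p : PairSpace zl zr) (t : I) :
    vel (pairCurve p) t = pairSpeed p t • frame4 (pairFrame p t) 1 := by
  have h := (hasVel_pairFrame_zero p t).clm
    quatEquiv.toContinuousLinearEquiv.toContinuousLinearMap
  rw [map_smul] at h
  exact h.vel_eq

theorem hasVel_pairTangent (p : PairSpace zl zr) (t : I) :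
    HasVel (fun r => frame4 (pairFrame p r) 1) (-(pairSpeed p t) • frame4 (pairFrame p t) 0 +
      ‖vel p.1.1.1 t‖ • frame4 (pairFrame p t) 2) t := by
  have h := (hasVel_pairFrame_one p t).clm
    quatEquiv.toContinuousLinearEquiv.toContinuousLinearMap
  rw [map_add, map_smul, map_smul] at h
  exact h

theorem pairCurve_frenet (p : PairSpace zl zr) :
    IsGeneric (pairCurve p) ∧ ∀ t, frenetVec (pairCurve p) t = frame4 (pairFrame p t) := by
  refine frenet_of_movingFrame3 (v := pairSpeed p) (a0 := fun t => -(pairSpeed p t) ^ 2)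
    (a1 := vel (pairSpeed p)) (c := fun t => pairSpeed p t * ‖vel p.1.1.1 t‖)
    (fun t => rfl) (pairSpeed_pos p) (vel_pairCurve p)
    (fun t => mul_pos (pairSpeed_pos p t) (p.1.1.2.1.1.speed_pos2 t)) (fun t => ?_)
  have e : vel (pairCurve p) = fun r => pairSpeed p r • frame4 (pairFrame p r) 1 :=
    funext (vel_pairCurve p)
  rw [e, ((smoothFamily_pairSpeed.hasVel p t).smul (hasVel_pairTangent p t)).vel_eq]
  module

end Backward

/-! ### The homeomorphism -/

section Correspondence

variable {zl zr : Spin3}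

theorem Pi3_one : Pi3 1 = 1 := by
  ext i j
  fin_cases i <;> fin_cases j <;> simp [Pi3, coords]

theorem Pi4_one : Pi4 1 = 1 := by
  ext i j
  fin_cases i <;> fin_cases j <;> simp [Pi4, coords]

theorem frenetVec_of_isLiftedFrame {γ : GS3 zl zr} {a b : C(I, Spin3)}
    (h : IsLiftedFrame Pi4 γ.1 (a.prodMk b)) (t : I) : frenetVec γ.1 t = frame4 (a t, b t) :=
  Pi4_eq_frenetFrame_iff.1 (h.2 t)

theorem exists_isLiftedFrame (γ : GS3 zl zr) : ∃ a b : C(I, Spin3),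
    IsLiftedFrame Pi4 γ.1 (a.prodMk b) ∧ a 1 = zl ∧ b 1 = zr := by
  obtain ⟨w, hw, hw1⟩ := γ.2.2
  exact ⟨ContinuousMap.fst.comp w, ContinuousMap.snd.comp w, hw, congrArg Prod.fst hw1,
    congrArg Prod.snd hw1⟩

theorem isLiftedFrame_leftCurve {γ : GS3 zl zr} {a b : C(I, Spin3)}
    (h : IsLiftedFrame Pi4 γ.1 (a.prodMk b)) : IsLiftedFrame Pi3 (leftCurve γ) a :=
  ⟨congrArg Prod.fst h.1, fun t => Pi3_eq_frenetFrame_iff.2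
    ((leftCurve_frenet (frenetVec_of_isLiftedFrame h)).2.1 t)⟩

theorem isLiftedFrame_rightCurve {γ : GS3 zl zr} {a b : C(I, Spin3)}
    (h : IsLiftedFrame Pi4 γ.1 (a.prodMk b)) : IsLiftedFrame Pi3 (rightCurve γ) b :=
  ⟨congrArg Prod.snd h.1, fun t => Pi3_eq_frenetFrame_iff.2
    ((rightCurve_frenet (frenetVec_of_isLiftedFrame h)).2.1 t)⟩

theorem mem_GS2_of_isLiftedFrame {z : Spin3} {γ : SmoothCurve (Euc (2 + 1))} {w : C(I, Spin3)}
    (hγ : IsGeneric γ) (h : IsLiftedFrame Pi3 γ w) (h1 : w 1 = z) :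
    InGQ (Pi3 z) γ ∧ ∃ w : C(I, Spin3), IsLiftedFrame Pi3 γ w ∧ w 1 = z :=
  ⟨⟨hγ, by rw [← h.2 0, h.1, Pi3_one], by rw [← h.2 1, h1]⟩, w, h, h1⟩

/-- The map `γ ↦ γₗ`. -/
noncomputable def leftPart (γ : GS3 zl zr) : GS2 zl :=
  ⟨leftCurve γ, by
    obtain ⟨a, b, h, ha, -⟩ := exists_isLiftedFrame γ
    exact mem_GS2_of_isLiftedFrame (leftCurve_frenet (frenetVec_of_isLiftedFrame h)).1
      (isLiftedFrame_leftCurve h) ha⟩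

/-- The map `γ ↦ γᵣ`. -/
noncomputable def rightPart (γ : GS3 zl zr) : GS2 zr :=
  ⟨rightCurve γ, by
    obtain ⟨a, b, h, -, hb⟩ := exists_isLiftedFrame γ
    exact mem_GS2_of_isLiftedFrame (rightCurve_frenet (frenetVec_of_isLiftedFrame h)).1
      (isLiftedFrame_rightCurve h) hb⟩

theorem speed_geodCurv_parts (γ : GS3 zl zr) (t : I) :
    ‖vel (leftPart γ).1 t‖ = ‖vel γ.1 t‖ * geodCurv γ.1 t ∧
    ‖vel (rightPart γ).1 t‖ = ‖vel γ.1 t‖ * geodCurv γ.1 t ∧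
    geodCurv (leftPart γ).1 t = (geodTors γ.1 t + 1) / geodCurv γ.1 t ∧
    geodCurv (rightPart γ).1 t = (geodTors γ.1 t - 1) / geodCurv γ.1 t := by
  obtain ⟨a, b, h, -, -⟩ := exists_isLiftedFrame γ
  have hl := (leftCurve_frenet (frenetVec_of_isLiftedFrame h)).2.2
  have hr := (rightCurve_frenet (frenetVec_of_isLiftedFrame h)).2.2
  exact ⟨hl.1 t, hr.1 t, hl.2 t, hr.2 t⟩

/-- The map `γ ↦ (γₗ, γᵣ)`. -/
noncomputable def parts (γ : GS3 zl zr) : PairSpace zl zr :=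
  ⟨(leftPart γ, rightPart γ), fun t => by
    obtain ⟨h1, h2, h3, h4⟩ := speed_geodCurv_parts γ t
    refine ⟨h1.trans h2.symm, ?_⟩
    simp only [h3, h4]
    exact div_lt_div_of_pos_right (by linarith) (GS3.vel_unitTangent γ t).1⟩

theorem isLiftedFrame_pairCurve (p : PairSpace zl zr) :
    IsLiftedFrame Pi4 (pairCurve p) ((GS2.lift p.1.1).prodMk (GS2.lift p.1.2)) :=
  ⟨Prod.ext (GS2.isLiftedFrame_lift p.1.1).1 (GS2.isLiftedFrame_lift p.1.2).1,
    fun t => Pi4_eq_frenetFrame_iff.2 ((pairCurve_frenet p).2 t)⟩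

/-- The map `(γₗ, γᵣ) ↦ wₗ w̄ᵣ`, where `wₗ` and `wᵣ` are the lifted Frenet frames. -/
noncomputable def combine (p : PairSpace zl zr) : GS3 zl zr :=
  ⟨pairCurve p, by
    have h := isLiftedFrame_pairCurve p
    have h1 : (GS2.lift p.1.1).prodMk (GS2.lift p.1.2) 1 = (zl, zr) :=
      Prod.ext (GS2.lift_one p.1.1) (GS2.lift_one p.1.2)
    exact ⟨⟨(pairCurve_frenet p).1, by rw [← h.2 0, h.1, Pi4_one], by rw [← h.2 1, h1]⟩, _, h, h1⟩⟩

theorem SmoothCurve.ext_apply {E : Type*} [NormedAddCommGroup E] [NormedSpace ℝ E]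
    {γ δ : SmoothCurve E} (h : ∀ t, γ t = δ t) : γ = δ := by
  cases γ
  cases δ
  congr
  exact funext h

theorem combine_parts (γ : GS3 zl zr) : combine (parts γ) = γ := by
  obtain ⟨a, b, h, -, -⟩ := exists_isLiftedFrame γ
  have ha : GS2.lift (leftPart γ) = a :=
    (GS2.isLiftedFrame_lift _).unique (isLiftedFrame_leftCurve h)
  have hb : GS2.lift (rightPart γ) = b :=
    (GS2.isLiftedFrame_lift _).unique (isLiftedFrame_rightCurve h)
  refine Subtype.ext (SmoothCurve.ext_apply fun t => ?_)
  change frame4 (GS2.lift (leftPart γ) t, GS2.lift (rightPart γ) t) 0 = _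
  rw [ha, hb, ← frenetVec_of_isLiftedFrame h, γ.2.1.1.frenetVec_zero3]

theorem parts_combine (p : PairSpace zl zr) : parts (combine p) = p := by
  have h : IsLiftedFrame Pi4 (combine p).1 ((GS2.lift p.1.1).prodMk (GS2.lift p.1.2)) :=
    isLiftedFrame_pairCurve p
  refine Subtype.ext (Prod.ext (Subtype.ext (SmoothCurve.ext_apply fun t => ?_))
    (Subtype.ext (SmoothCurve.ext_apply fun t => ?_)))
  · change leftCurve (combine p) t = _
    rw [leftCurve_eq (frenetVec_of_isLiftedFrame h), ← GS2.frenetVec_eq,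
      p.1.1.2.1.1.frenetVec_zero2]
  · change rightCurve (combine p) t = _
    rw [rightCurve_eq (frenetVec_of_isLiftedFrame h), ← GS2.frenetVec_eq,
      p.1.2.2.1.1.frenetVec_zero2]

variable (zl zr) in
/-- The homeomorphism `γ ↦ (γₗ, γᵣ)`. -/
noncomputable def partsHomeomorph : GS3 zl zr ≃ₜ PairSpace zl zr where
  toFun := parts
  invFun := combine
  left_inv := combine_parts
  right_inv := parts_combine
  continuous_toFun := ((continuous_leftCurve.subtype_mk _).prodMk
    (continuous_rightCurve.subtype_mk _)).subtype_mk _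
  continuous_invFun := continuous_pairCurve.subtype_mk _

end Correspondence

end SphereCurves

open SphereCurves
theorem theorem3 (zl zr : Spin3) :
    ∃ Φ : GS3 zl zr ≃ₜ PairSpace zl zr,
      ∀ (γ : GS3 zl zr) (γl : GS2 zl) (γr : GS2 zr),
        (Φ γ).1 = (γl, γr) →
        -- the lifted Frenet frame of `γ` is the pair of the lifted Frenet frames of `γl` and `γr`
        (∀ wl wr : C(I, Spin3),
          IsLiftedFrame Pi4 γ.1 (wl.prodMk wr) ↔
            IsLiftedFrame Pi3 γl.1 wl ∧
              IsLiftedFrame Pi3 γr.1 wr) ∧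
        -- speeds, curvatures and torsion
        ∀ t : I,
          0 < ‖vel γ.1 t‖ ∧
          0 < geodCurv γ.1 t ∧
          ‖vel γl.1 t‖ = ‖vel γ.1 t‖ * geodCurv γ.1 t ∧
          ‖vel γr.1 t‖ = ‖vel γ.1 t‖ * geodCurv γ.1 t ∧
          geodCurv γl.1 t =
            (geodTors γ.1 t + 1) / geodCurv γ.1 t ∧
          geodCurv γr.1 t =
            (geodTors γ.1 t - 1) / geodCurv γ.1 t ∧
          geodCurv γ.1 t =
            2 / (geodCurv γl.1 t - geodCurv γr.1 t) ∧
          geodTors γ.1 t =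
            (geodCurv γl.1 t + geodCurv γr.1 t) /
              (geodCurv γl.1 t - geodCurv γr.1 t) ∧
          ‖vel γ.1 t‖ =
            ‖vel γl.1 t‖ *
              (geodCurv γl.1 t - geodCurv γr.1 t) / 2 := by
  refine ⟨partsHomeomorph zl zr, fun γ γl γr hγ => ?_⟩
  obtain ⟨rfl, rfl⟩ : leftPart γ = γl ∧ rightPart γ = γr := Prod.mk.inj hγ
  refine ⟨fun wl wr => ⟨fun h => ⟨isLiftedFrame_leftCurve h, isLiftedFrame_rightCurve h⟩,
    fun h => ?_⟩, fun t => ?_⟩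
  · -- by uniqueness of lifts, `wl` and `wr` are the components of the lifted frame of `γ`
    obtain ⟨a, b, hab, -, -⟩ := exists_isLiftedFrame γ
    rw [h.1.unique (isLiftedFrame_leftCurve hab), h.2.unique (isLiftedFrame_rightCurve hab)]
    exact hab
  · obtain ⟨h1, h2, h3, h4⟩ := speed_geodCurv_parts γ t
    have hκ := (GS3.vel_unitTangent γ t).1
    have hsub : geodCurv (leftPart γ).1 t - geodCurv (rightPart γ).1 t =
        2 / geodCurv γ.1 t := by
      rw [h3, h4]
      ring
    have hadd : geodCurv (leftPart γ).1 t + geodCurv (rightPart γ).1 t =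
        2 * geodTors γ.1 t / geodCurv γ.1 t := by
      rw [h3, h4]
      ring
    refine ⟨γ.2.1.1.speed_pos3 t, hκ, h1, h2, h3, h4, ?_, ?_, ?_⟩
    · rw [hsub]
      field_simp
    · rw [hsub, hadd]
      field_simp
    · rw [hsub, h1]
      field_simp
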